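/- Let $S=[-1,1]^2$. For $r>0$, $\theta\in[0,\pi/2)$ and $p\in\mathbb R^2$, a *square* with radius $r$, angle $\theta$ and centre $p$ is the set $rR_\theta S+p$, where $R_\theta$ is the anticlockwise rotation by $\theta$. A *packing of $n$ squares* with radii $r_1,\dots,r_n$ is a family $S_1,\dots,S_n$ of squares, $S_i=r_iR_{\theta_i}S+p_i$, whose interiors are pairwise disjoint. It is called *homothetic up to rotation* if some rotation of the plane maps every $S_i$ to a set of the form $rS+p$ with $r>0$ and $p\in\mathbb R^2$. Two distinct squares $S_i,S_j$ have a *face-to-face contact* if $S_i\cap S_j$ is a line segment $[z,z']$ with $z\neq z'$. Let $n\ge 1$ and let $r_1,\dots,r_n>0$ satisfy the *weak generic condition*: the only function $\sigma:\{1,\dots,n\}\to\{-1,0,1\}$ with at least four zeroes and $\sum_{i=1}^n\sigma_i r_i=0$ is the zero function (if $n<4$, the condition is vacuous). Then every packing of $n$ squares with radii $r_1,\dots,r_n$ has at most $2n-2$ face-to-face contacts. Furthermore, if such a packing has exactly $2n-2$ face-to-face contacts, then it is homothetic up to rotation and no four of its squares share a corner; in fact no point of the plane lies in four of the squares. -/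

import Mathlib

noncomputable section

/-- The standard square `S = {(x, y) : -1 ≤ x, y ≤ 1}`. -/
def standardSquare : Set (ℝ × ℝ) :=
  {q | -1 ≤ q.1 ∧ q.1 ≤ 1 ∧ -1 ≤ q.2 ∧ q.2 ≤ 1}

/-- Anticlockwise rotation of the plane by `θ` radians about the origin. -/
def planeRotation (θ : ℝ) (q : ℝ × ℝ) : ℝ × ℝ :=
  (Real.cos θ * q.1 - Real.sin θ * q.2, Real.sin θ * q.1 + Real.cos θ * q.2)

/-- The similar copy `r R_θ S + p` of the standard square. -/
def similarSquare (r θ : ℝ) (p : ℝ × ℝ) : Set (ℝ × ℝ) :=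
  (fun q => r • planeRotation θ q + p) '' standardSquare

/-- `B` is a homothetic copy `r A + p`, with `r > 0`, of `A`. -/
def IsHomotheticCopy (A B : Set (ℝ × ℝ)) : Prop :=
  ∃ r : ℝ, 0 < r ∧ ∃ p : ℝ × ℝ, B = (fun q => r • q + p) '' A

/-- The radii `r_1, …, r_n` satisfy the weak generic condition: the only function
`σ : [n] → {-1, 0, 1}` with at least four zeroes and `∑ σ_i r_i = 0` is the zero function. -/
def WeakGeneric {n : ℕ} (r : Fin n → ℝ) : Prop :=
  ∀ σ : Fin n → ℤ, (∀ i, σ i = -1 ∨ σ i = 0 ∨ σ i = 1) →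
    4 ≤ (Finset.univ.filter fun i => σ i = 0).card →
    ∑ i, (σ i : ℝ) * r i = 0 → ∀ i, σ i = 0

/-- A packing of `n` (possibly rotated) squares with radii `r_1, …, r_n`: the squares have
pairwise disjoint interiors. -/
structure SquarePacking {n : ℕ} (r : Fin n → ℝ) where
  center : Fin n → ℝ × ℝ
  angle : Fin n → ℝ
  angle_mem : ∀ i, angle i ∈ Set.Ico 0 (Real.pi / 2)
  interior_disjoint : ∀ i j, i ≠ j →
    Disjoint (interior (similarSquare (r i) (angle i) (center i)))
      (interior (similarSquare (r j) (angle j) (center j)))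

namespace SquarePacking

variable {n : ℕ} {r : Fin n → ℝ}

/-- The `i`-th square of the packing. -/
def square (P : SquarePacking r) (i : Fin n) : Set (ℝ × ℝ) :=
  similarSquare (r i) (P.angle i) (P.center i)

/-- The graph of face-to-face contacts: distinct `i`, `j` are adjacent when the intersection
of the two squares is a line segment `[z, z']` with `z ≠ z'`. -/
def faceGraph (P : SquarePacking r) : SimpleGraph (Fin n) where
  Adj i j := i ≠ j ∧ ∃ z z' : ℝ × ℝ, z ≠ z' ∧ P.square i ∩ P.square j = segment ℝ z z'
  symm := ⟨fun _ _ h => ⟨h.1.symm, by simpa only [Set.inter_comm] using h.2⟩⟩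
  loopless := ⟨fun _ h => h.1 rfl⟩

/-- The number of face-to-face contacts (unordered pairs of squares). -/
def numFaceContacts (P : SquarePacking r) : ℕ := P.faceGraph.edgeSet.ncard

/-- The packing is a homothetic square packing, up to one rotation of the whole plane. -/
def IsHomothetic (P : SquarePacking r) : Prop :=
  ∃ φ : ℝ, ∀ i, IsHomotheticCopy standardSquare (planeRotation φ '' P.square i)

/-- Some four squares share a corner, i.e. have a common point. (In a homothetic packing such a
point is necessarily a corner of each of the four squares, as the interiors are disjoint.) -/
def HasFourSharingCorner (P : SquarePacking r) : Prop :=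
  ∃ T : Finset (Fin n), T.card = 4 ∧ (⋂ i ∈ T, P.square i).Nonempty

end SquarePacking

end

/-! A face-to-face contact segment is parallel to a side of both squares, so the two angles agree
and the packing splits into classes of equal angle. It suffices that a class of m axis-parallel
squares has at most 2m - 2 contacts: each class then costs 2, and equality overall forces a single
angle.

In a class, let E be the contacts across vertical sides and F those across horizontal sides. If both
graphs are forests, each has at most m - 1 edges. Suppose E has a cycle. Adding the horizontal
displacements around it gives a vanishing signed sum of radii, in which a square has sign zero
exactly when it is off the cycle or the cycle turns there. The relation is not trivial: otherwise
the cycle turns everywhere and all its contacts lie on one line, where the square with the lowest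
top cannot have two neighbours. Genericity then allows at most three zeros. Hence there are exactly
two turns, and at most one square w is off the cycle: the cycle consists of two chains from a
leftmost square z to a rightmost square z' (`SideContact.exists_monotone_cycle`).

Genericity, applied to differences of partial chain sums, also forbids the two chains to have
coinciding break points before the forced one at z' (`TwoChains.break_points`). So E has at most as
many contacts on the chains as there are chain members. In F, the squares z and z' can only touch w,
so F is a forest and loses two vertices almost for free. Each contact of w with z or z' in F
excludes E-contacts of w on the corresponding side, and the count closes
(`SideContact.pairCount_add_le_of_cycle`).

If four squares of a class share a point, they surround it, and the diagonal pair at that point can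
be added as one more contact in either direction without creating a core on a line
(`sideContact_sideTouch_or`). The same count then gives 2m - 3. -/

/-! ### Cycles and forests in graphs -/

/-- A graph with a cycle carries a periodic vertex sequence running around that cycle. -/
theorem SimpleGraph.exists_periodic_of_not_isAcyclic {V : Type*} {G : SimpleGraph V}
    (h : ¬ G.IsAcyclic) :
    ∃ (k : ℕ) (f : ℕ → V), 3 ≤ k ∧ (∀ j, f (j + k) = f j) ∧ (∀ j, G.Adj (f j) (f (j + 1))) ∧
      ∀ i j, f i = f j → i ≡ j [MOD k] := by
  rw [SimpleGraph.isAcyclic_iff_free_cycleGraph] at h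
  push Not at h
  obtain ⟨k, hk, ⟨φ⟩⟩ := h
  obtain ⟨m, rfl⟩ : ∃ m, k = m + 3 := ⟨k - 3, by omega⟩
  refine ⟨m + 3, fun j => φ (Fin.ofNat (m + 3) j), hk, ?_, ?_, ?_⟩
  · intro j
    exact congrArg φ (Fin.ext (by simp))
  · intro j
    apply φ.toHom.map_adj
    rw [SimpleGraph.cycleGraph_adj]
    right
    have : Fin.ofNat (m + 3) (j + 1) = Fin.ofNat (m + 3) j + 1 := by
      ext
      simp [Fin.val_add]
    rw [this, add_sub_cancel_left]
  · intro i j hij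
    have := φ.injective hij
    change i % (m + 3) = j % (m + 3)
    simpa [Fin.ext_iff] using this

/-- A forest on a nonempty vertex set has fewer edges than vertices. -/
theorem SimpleGraph.IsAcyclic.ncard_edgeSet_lt {V : Type*} [Fintype V] [Nonempty V]
    {G : SimpleGraph V} (h : G.IsAcyclic) : G.edgeSet.ncard + 1 ≤ Fintype.card V := by
  classical
  obtain ⟨T, hGT, hT⟩ :=
    SimpleGraph.exists_maximal_isAcyclic_of_le_isAcyclic (le_top : G ≤ ⊤) h
  have hT' : T.IsTree := SimpleGraph.maximal_isAcyclic_iff_isTree.1 (by simpa using hT)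
  rw [← hT'.card_edgeFinset, ← SimpleGraph.coe_edgeFinset, Set.ncard_coe_finset]
  exact Nat.add_le_add_right (Finset.card_le_card (SimpleGraph.edgeFinset_mono hGT)) 1

/-! ### Sign relations and systems of contacting intervals -/

/-- A vanishing signed sum of the `r i` with at least four zero signs is trivial. -/
def FewZeroSigns {V : Type*} [Fintype V] (r : V → ℝ) : Prop :=
  ∀ σ : V → ℤ, (∀ i, σ i = -1 ∨ σ i = 0 ∨ σ i = 1) → ∑ i, (σ i : ℝ) * r i = 0 →
    ∀ T : Finset V, 4 ≤ T.card → (∀ i ∈ T, σ i = 0) → ∀ i, σ i = 0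

/-- `E i j` records a contact of the right end of `[x i - r i, x i + r i]` with the left end of
`[x j - r j, x j + r j]`; contacts along one line have no subgraph of minimum degree two. -/
structure SideContact {V : Type*} (x r : V → ℝ) (E : V → V → Prop) : Prop where
  pos : ∀ i, 0 < r i
  gap : ∀ i j, E i j → x j - x i = r i + r j
  no_core : ∀ (T : Finset V) (v : ℝ), T.Nonempty → ¬ ∀ i ∈ T,
    (x i + r i = v ∧ ∃ j ∈ T, ∃ j' ∈ T, j ≠ j' ∧ E i j ∧ E i j') ∨
    (x i - r i = v ∧ ∃ j ∈ T, ∃ j' ∈ T, j ≠ j' ∧ E j i ∧ E j' i)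

/-- The first place after `a` where a sequence of signs changes. -/
theorem exists_first_sign_change (e : ℕ → ℤ) (he : ∀ j, e j = 1 ∨ e j = -1) {a b : ℕ}
    (hab : a ≤ b) (h : e a ≠ e b) :
    ∃ t, a < t ∧ t ≤ b ∧ (∀ j, a ≤ j → j < t → e j = e a) ∧ e t = - e a := by
  classical
  have hex : ∃ t, a ≤ t ∧ e t ≠ e a := ⟨b, hab, h.symm⟩
  obtain ⟨h1, h2⟩ := Nat.find_spec hex
  refine ⟨Nat.find hex, ?_, Nat.find_min' hex ⟨hab, h.symm⟩, ?_, ?_⟩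
  · rcases h1.lt_or_eq with h | h
    · exact h
    · exact absurd (congrArg e h).symm h2
  · intro j hj hjt
    by_contra hne
    exact Nat.find_min hex hjt ⟨hj, hne⟩
  · rcases he (Nat.find hex) with h3 | h3 <;> rcases he a with h4 | h4 <;>
      rw [h3, h4] at h2 ⊢ <;> simp at h2 ⊢

theorem sum_range_shift_of_eq {k : ℕ} (g : ℕ → ℝ) (h : g k = g 0) :
    ∑ j ∈ Finset.range k, g (j + 1) = ∑ j ∈ Finset.range k, g j := by
  have h1 := Finset.sum_range_succ g k
  have h2 := Finset.sum_range_succ' g k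
  linarith

/-- The signed relation carried by a closed sequence of contacts. -/
theorem sum_turning_signs_eq_zero {k : ℕ} (hk : 1 ≤ k) (x r : ℕ → ℝ) (e : ℕ → ℤ)
    (hx : x k = x 0) (hr : r k = r 0) (he : ∀ j, e (j + k) = e j)
    (h : ∀ j, x (j + 1) - x j = e j * (r j + r (j + 1))) :
    ∑ j ∈ Finset.range k, ((e j + e (j + k - 1) : ℤ) : ℝ) * r j = 0 := by
  have h1 : ∑ j ∈ Finset.range k, (x (j + 1) - x j) = 0 := by
    rw [Finset.sum_range_sub, hx, sub_self]
  -- The index `j + k - 1` stands for the predecessor of `j` modulo the period, which avoids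
  -- truncated subtraction at `j = 0`.
  have h2 := sum_range_shift_of_eq (k := k) (fun j => (e (j + k - 1) : ℝ) * r j) (by
    have : k + k - 1 = (0 + k - 1) + k := by omega
    simp only [hr]
    rw [this, he])
  have h3 : ∀ j, e (j + 1 + k - 1) = e j := fun j => by
    rw [show j + 1 + k - 1 = j + k by omega, he]
  simp only [h3] at h2
  simp only [h, mul_add, Finset.sum_add_distrib] at h1
  push_cast
  simp only [add_mul, Finset.sum_add_distrib]
  linarith

theorem Nat.not_modEq_of_lt {k i j : ℕ} (hij : i < j) (hjk : j < i + k) : ¬ i ≡ j [MOD k] := by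
  intro h
  have := (Nat.modEq_iff_dvd' hij.le).1 h
  have := Nat.le_of_dvd (by omega) this
  omega

/-! ### A cycle of contacts turns exactly twice -/

section

variable {V : Type*} [Fintype V] {x r : V → ℝ} {E : V → V → Prop}

/-- In a cycle of contacts starting at a leftmost interval, exactly two intervals are turning
points, and at most one interval is not on the cycle. -/
theorem SideContact.exists_monotone_cycle (hE : SideContact x r E) (hg : FewZeroSigns r)
    (hc : ¬ (SimpleGraph.fromRel E).IsAcyclic) :
    ∃ (k p : ℕ) (f : ℕ → V), 3 ≤ k ∧ 0 < p ∧ p < k ∧ (∀ j, f (j + k) = f j) ∧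
      (∀ i j, f i = f j → i ≡ j [MOD k]) ∧ (∀ j, j < p → E (f j) (f (j + 1))) ∧
      (∀ j, p ≤ j → j < k → E (f (j + 1)) (f j)) ∧
      (∀ i i', (∀ j, f j ≠ i) → (∀ j, f j ≠ i') → i = i') := by
  classical
  obtain ⟨k, f₀, hk, hper₀, hadj₀, hinj₀⟩ := SimpleGraph.exists_periodic_of_not_isAcyclic hc
  -- The cycle is rotated to start at a leftmost left end, so that its first step goes right and its
  -- last step goes left.
  obtain ⟨j₀, -, hmin₀⟩ := Finset.exists_min_image (Finset.range k)
    (fun j => x (f₀ j) - r (f₀ j)) ⟨0, Finset.mem_range.2 (by omega)⟩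
  have hmod₀ : ∀ j, f₀ (j % k) = f₀ j := Function.Periodic.map_mod_nat hper₀
  obtain ⟨f, hf⟩ : ∃ f : ℕ → V, ∀ j, f j = f₀ (j + j₀) := ⟨_, fun _ => rfl⟩
  have hper : ∀ j, f (j + k) = f j := fun j => by
    rw [hf, hf, show j + k + j₀ = j + j₀ + k by omega, hper₀]
  have hadj : ∀ j, E (f j) (f (j + 1)) ∨ E (f (j + 1)) (f j) := fun j => by
    rw [hf, hf, show j + 1 + j₀ = j + j₀ + 1 by omega]
    exact (hadj₀ (j + j₀)).2
  have hinj : ∀ i j, f i = f j → i ≡ j [MOD k] := fun i j hij => by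
    rw [hf, hf] at hij
    exact Nat.ModEq.add_right_cancel' j₀ (hinj₀ _ _ hij)
  have hmin : ∀ j, x (f 0) - r (f 0) ≤ x (f j) - r (f j) := fun j => by
    have := hmin₀ ((j + j₀) % k) (Finset.mem_range.2 (Nat.mod_lt _ (by omega)))
    simpa [hf, hmod₀] using this
  clear hmod₀ hmin₀ hinj₀ hadj₀ hper₀ hf
  have hmod : ∀ j, f (j % k) = f j := Function.Periodic.map_mod_nat hper
  obtain ⟨e, he⟩ : ∃ e : ℕ → ℤ, ∀ j, e j = if E (f j) (f (j + 1)) then 1 else -1 :=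
    ⟨_, fun _ => rfl⟩
  have he1 : ∀ j, e j = 1 ∨ e j = -1 := fun j => by
    rw [he]; split_ifs <;> simp
  have hepos : ∀ j, e j = 1 → E (f j) (f (j + 1)) := fun j h => by
    rw [he] at h
    by_contra hn
    simp [hn] at h
  have heneg : ∀ j, e j = -1 → E (f (j + 1)) (f j) := fun j h => by
    rw [he] at h
    refine (hadj j).resolve_left fun hn => ?_
    simp [hn] at h
  have hekper : ∀ j, e (j + k) = e j := fun j => by
    rw [he, he, show j + k + 1 = j + 1 + k by omega, hper, hper]
  have hstep : ∀ j, x (f (j + 1)) - x (f j) = e j * (r (f j) + r (f (j + 1))) := fun j => by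
    rcases he1 j with h | h
    · rw [h, hE.gap _ _ (hepos j h)]; simp
    · have := hE.gap _ _ (heneg j h)
      rw [h]; push_cast; linarith
  have hsum := sum_turning_signs_eq_zero (k := k) (by omega) (fun j => x (f j)) (fun j => r (f j)) e
    (by simpa using congrArg x (hper 0)) (by simpa using congrArg r (hper 0)) hekper hstep
  -- Half of the coefficient in `hsum`: a sign where the cycle goes straight on, zero where it
  -- turns.
  obtain ⟨s, hs⟩ : ∃ s : ℕ → ℤ, ∀ j, s j = if e j = e (j + k - 1) then e j else 0 :=
    ⟨_, fun _ => rfl⟩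
  have hs2 : ∀ j, e j + e (j + k - 1) = 2 * s j := fun j => by
    rw [hs]
    rcases he1 j with h | h <;> rcases he1 (j + k - 1) with h' | h' <;> rw [h, h'] <;> simp
  have hinjOn : ∀ i < k, ∀ j < k, f i = f j → i = j := fun i hi j hj hij =>
    Nat.ModEq.eq_of_lt_of_lt (hinj i j hij) hi hj
  obtain ⟨σ, hσ⟩ : ∃ σ : V → ℤ, ∀ i, σ i = ∑ j ∈ Finset.range k, if f j = i then s j else 0 :=
    ⟨_, fun _ => rfl⟩
  have hσf : ∀ j < k, σ (f j) = s j := fun j hj => by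
    rw [hσ, Finset.sum_eq_single j]
    · simp
    · intro b hb hbj
      rw [if_neg]
      exact fun h => hbj (hinjOn b (Finset.mem_range.1 hb) j hj h)
    · intro h; exact absurd (Finset.mem_range.2 hj) h
  have hσ0 : ∀ i, (∀ j, f j ≠ i) → σ i = 0 := fun i hi => by
    rw [hσ]
    exact Finset.sum_eq_zero fun j _ => if_neg (hi j)
  have hσval : ∀ i, σ i = -1 ∨ σ i = 0 ∨ σ i = 1 := fun i => by
    by_cases hi : ∀ j, f j ≠ i
    · exact Or.inr (Or.inl (hσ0 i hi))
    · push Not at hi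
      obtain ⟨j, rfl⟩ := hi
      rw [← hmod, hσf _ (Nat.mod_lt _ (by omega)), hs]
      rcases he1 (j % k) with h | h <;> split_ifs <;> simp [h]
  have hσsum : ∑ i, (σ i : ℝ) * r i = 0 := by
    have h1 : ∑ i, (σ i : ℝ) * r i = ∑ j ∈ Finset.range k, (s j : ℝ) * r (f j) := by
      simp only [hσ, Int.cast_sum, Finset.sum_mul]
      rw [Finset.sum_comm]
      refine Finset.sum_congr rfl fun j _ => ?_
      rw [Finset.sum_eq_single (f j)]
      · simp
      · intro b _ hb
        rw [if_neg hb.symm]; simp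
      · simp
    have h2 : ∑ j ∈ Finset.range k, (s j : ℝ) * r (f j) * 2 = 0 := by
      rw [← hsum]
      refine Finset.sum_congr rfl fun j _ => ?_
      rw [hs2]; push_cast; ring
    rw [← Finset.sum_mul] at h2
    rw [h1]; linarith
  have he0 : e 0 = 1 := by
    refine (he1 0).resolve_right fun h => ?_
    have h1 := hE.gap _ _ (heneg 0 h)
    have h2 := hmin 1
    have := hE.pos (f 1)
    have := hE.pos (f 0)
    simp only [zero_add] at *
    linarith
  -- the relation is nontrivial, as otherwise all contacts lie along one line
  have hnontriv : ¬ ∀ i, σ i = 0 := by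
    intro hall
    have hsper : ∀ j, s (j + k) = s j := fun j => by
      rw [hs, hs, hekper, show j + k + k - 1 = j + k - 1 + k by omega, hekper]
    have halt : ∀ j, e (j + 1) = - e j := by
      intro j
      have h1 := hall (f ((j + 1) % k))
      rw [hσf _ (Nat.mod_lt _ (by omega)), Function.Periodic.map_mod_nat hsper, hs,
        show j + 1 + k - 1 = j + k by omega, hekper] at h1
      rcases he1 j with h | h <;> rcases he1 (j + 1) with h' | h' <;> rw [h, h'] at h1 ⊢ <;>
        simp at h1 ⊢
    have hline : ∀ j, (e j = 1 ∧ x (f j) + r (f j) = x (f 0) + r (f 0)) ∨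
        (e j = -1 ∧ x (f j) - r (f j) = x (f 0) + r (f 0)) := by
      intro j
      induction j with
      | zero => exact Or.inl ⟨he0, rfl⟩
      | succ j ih =>
        rcases ih with ⟨h1, h2⟩ | ⟨h1, h2⟩
        · have := hE.gap _ _ (hepos j h1)
          exact Or.inr ⟨by rw [halt, h1], by linarith⟩
        · have := hE.gap _ _ (heneg j h1)
          exact Or.inl ⟨by rw [halt, h1]; simp, by linarith⟩
    have hmem : ∀ j, f j ∈ (Finset.range k).image f := fun j =>
      Finset.mem_image.2 ⟨j % k, Finset.mem_range.2 (Nat.mod_lt _ (by omega)), hmod j⟩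
    refine hE.no_core ((Finset.range k).image f) (x (f 0) + r (f 0)) ⟨f 0, hmem 0⟩ fun i hi => ?_
    obtain ⟨j, -, rfl⟩ := Finset.mem_image.1 hi
    have hne : f (j + 1) ≠ f (j + k - 1) := fun h =>
      Nat.not_modEq_of_lt (by omega) (by omega) (hinj _ _ h)
    have hprev : f (j + k - 1 + 1) = f j := by
      rw [show j + k - 1 + 1 = j + k by omega, hper]
    have heprev : e (j + k - 1) = - e j := by
      have := halt (j + k - 1)
      rw [show j + k - 1 + 1 = j + k by omega, hekper] at this
      omega
    rcases hline j with ⟨h1, h2⟩ | ⟨h1, h2⟩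
    · refine Or.inl ⟨h2, _, hmem (j + 1), _, hmem (j + k - 1), hne, hepos j h1, ?_⟩
      have := heneg (j + k - 1) (by rw [heprev, h1])
      rwa [hprev] at this
    · refine Or.inr ⟨h2, _, hmem (j + 1), _, hmem (j + k - 1), hne, heneg j h1, ?_⟩
      have := hepos (j + k - 1) (by rw [heprev, h1]; simp)
      rwa [hprev] at this
  have hzeros : ∀ T : Finset V, (∀ i ∈ T, σ i = 0) → T.card ≤ 3 := fun T hT => by
    by_contra hcard
    exact hnontriv (hg σ hσval hσsum T (by omega) hT)
  have hek : e (k - 1) = -1 := by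
    refine (he1 (k - 1)).resolve_left fun h => ?_
    have h1 := hE.gap _ _ (hepos _ h)
    have h2 := hmin (k - 1)
    have h3 : f (k - 1 + 1) = f 0 := by
      rw [show k - 1 + 1 = 0 + k by omega, hper]
    rw [h3] at h1
    have := hE.pos (f (k - 1))
    have := hE.pos (f 0)
    linarith
  have hs0 : σ (f 0) = 0 := by
    rw [hσf 0 (by omega), hs, zero_add, he0, hek, if_neg (by norm_num)]
  have hturn : ∀ j, 0 < j → j < k → e j = - e (j - 1) → σ (f j) = 0 := fun j h0 hj h => by
    rw [hσf j hj, hs, if_neg]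
    rw [show j + k - 1 = j - 1 + k by omega, hekper, h]
    rcases he1 (j - 1) with h | h <;> rw [h] <;> norm_num
  obtain ⟨p, hp0, hpk, hpe, hep⟩ := exists_first_sign_change e he1 (a := 0) (b := k - 1)
    (by omega) (by rw [he0, hek]; norm_num)
  have hsp : σ (f p) = 0 := hturn p hp0 (by omega) (by rw [hep, hpe (p - 1) (by omega) (by omega)])
  rw [he0] at hep hpe
  -- A second rise at `t` forces a second fall at `w`, because the last sign is -1. Together with
  -- `0` and `p` this would make four zeros.
  have hneg : ∀ j, p ≤ j → j < k → e j = -1 := by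
    intro j hpj hjk
    by_contra hne
    have hj1 : e j = 1 := (he1 j).resolve_right hne
    obtain ⟨t, htp, htj, hte, het⟩ := exists_first_sign_change e he1 hpj
      (by rw [hep, hj1]; norm_num)
    have hst : σ (f t) = 0 := hturn t (by omega) (by omega)
      (by rw [het, hte (t - 1) (by omega) (by omega)])
    rw [hep] at het
    obtain ⟨w, hwt, hwk, hwe, hew⟩ := exists_first_sign_change e he1 (a := t) (b := k - 1)
      (by omega) (by rw [het, hek]; norm_num)
    have hsw : σ (f w) = 0 := hturn w (by omega) (by omega)
      (by rw [hew, hwe (w - 1) (by omega) (by omega)])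
    have hcard : (({0, p, t, w} : Finset ℕ).image f).card = 4 := by
      rw [Finset.card_image_of_injOn]
      · rw [Finset.card_insert_of_notMem, Finset.card_insert_of_notMem, Finset.card_pair] <;>
          simp <;> omega
      · intro a ha b hb hab
        simp only [Finset.coe_insert, Finset.coe_singleton, Set.mem_insert_iff,
          Set.mem_singleton_iff] at ha hb
        exact hinjOn a (by omega) b (by omega) hab
    have := hzeros (({0, p, t, w} : Finset ℕ).image f) (by simp [hs0, hsp, hst, hsw])
    omega
  refine ⟨k, p, f, hk, hp0, by omega, hper, hinj, fun j hj => hepos j (hpe j (by omega) hj),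
    fun j h1 h2 => heneg j (hneg j h1 h2), fun i i' hi hi' => ?_⟩
  by_contra hii
  have h0p : f 0 ≠ f p := fun h => by
    have := hinjOn 0 (by omega) p (by omega) h
    omega
  have hcard : ({f 0, f p, i, i'} : Finset V).card = 4 := by
    rw [Finset.card_insert_of_notMem, Finset.card_insert_of_notMem, Finset.card_pair hii]
    · simp [hi p, hi' p]
    · simp [h0p, hi 0, hi' 0]
  have := hzeros {f 0, f p, i, i'} (by simp [hs0, hsp, hσ0 i hi, hσ0 i' hi'])
  omega

end

/-! ### Two chains between the extreme intervals -/

section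

variable {V : Type*} {x r : V → ℝ} {E : V → V → Prop}

/-- Two chains of consecutive contacts with common first and last members and otherwise disjoint,
which miss at most one interval. -/
structure TwoChains (E : V → V → Prop) (a b : ℕ) (u l : ℕ → V) : Prop where
  first : u 0 = l 0
  last : u (a + 1) = l (b + 1)
  contact_u : ∀ j ≤ a, E (u j) (u (j + 1))
  contact_l : ∀ j ≤ b, E (l j) (l (j + 1))
  disj : ∀ s t, 1 ≤ s → s ≤ a → 1 ≤ t → t ≤ b → u s ≠ l t
  nondeg : 0 < a + b
  off_unique : ∀ i i', (∀ j ≤ a + 1, u j ≠ i) → (∀ j ≤ b + 1, l j ≠ i) →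
    (∀ j ≤ a + 1, u j ≠ i') → (∀ j ≤ b + 1, l j ≠ i') → i = i'

theorem SideContact.exists_twoChains [Fintype V] (hE : SideContact x r E) (hg : FewZeroSigns r)
    (hc : ¬ (SimpleGraph.fromRel E).IsAcyclic) :
    ∃ a b u l, TwoChains E a b u l := by
  obtain ⟨k, p, f, hk, hp0, hpk, hper, hinj, hup, hdown, hoff⟩ := hE.exists_monotone_cycle hg hc
  have hmod : ∀ j, f (j % k) = f j := Function.Periodic.map_mod_nat hper
  have hf0 : f k = f 0 := by simpa using hper 0
  have key : ∀ i, (∀ j ≤ p - 1 + 1, f j ≠ i) → (∀ j ≤ k - p - 1 + 1, f (k - j) ≠ i) →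
      ∀ j, f j ≠ i := by
    intro i h1 h2 j
    rw [← hmod]
    have hlt := Nat.mod_lt j (show 0 < k by omega)
    by_cases hj : j % k ≤ p
    · exact h1 _ (by omega)
    · have := h2 (k - j % k) (by omega)
      rwa [show k - (k - j % k) = j % k by omega] at this
  -- The falling part is read backwards from `f k = f 0`. The two numbers count interior members,
  -- hence the subtraction of one.
  refine ⟨p - 1, k - p - 1, f, fun j => f (k - j), by simpa using hf0.symm, ?_, ?_, ?_, ?_, by omega,
    ?_⟩
  · exact congrArg f (by omega)
  · exact fun j hj => hup j (by omega)
  · intro j hj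
    have := hdown (k - (j + 1)) (by omega) (by omega)
    rwa [show k - (j + 1) + 1 = k - j by omega] at this
  · intro s t h1 h2 h3 h4 h
    exact Nat.not_modEq_of_lt (by omega) (by omega) (hinj _ _ h)
  · exact fun i i' h1 h2 h3 h4 => hoff i i' (key i h1 h2) (key i' h3 h4)

theorem SideContact.right_le_left (hE : SideContact x r E) {a : ℕ} {u : ℕ → V}
    (hu : ∀ j ≤ a, E (u j) (u (j + 1))) {s t : ℕ} (hst : s < t) (ht : t ≤ a + 1) :
    x (u s) + r (u s) ≤ x (u t) - r (u t) := by
  induction t with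
  | zero => omega
  | succ t ih =>
    have h1 := hE.gap _ _ (hu t (by omega))
    rcases Nat.lt_succ_iff_lt_or_eq.1 hst with h | rfl
    · have := ih h (by omega)
      have := hE.pos (u t)
      linarith
    · linarith

theorem SideContact.right_eq_sum (hE : SideContact x r E) {a : ℕ} {u : ℕ → V}
    (hu : ∀ j ≤ a, E (u j) (u (j + 1))) {s : ℕ} (hs : s ≤ a + 1) :
    x (u s) + r (u s) = x (u 0) + r (u 0) + 2 * ∑ j ∈ Finset.range s, r (u (j + 1)) := by
  induction s with
  | zero => simp
  | succ s ih =>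
    have := ih (by omega)
    have h1 := hE.gap _ _ (hu s (by omega))
    rw [Finset.sum_range_succ]
    linarith

theorem SideContact.chain_injective (hE : SideContact x r E) {a : ℕ} {u : ℕ → V}
    (hu : ∀ j ≤ a, E (u j) (u (j + 1))) {s t : ℕ} (hs : s ≤ a + 1) (ht : t ≤ a + 1)
    (h : u s = u t) : s = t := by
  have hr := hE.pos (u t)
  rcases lt_trichotomy s t with hlt | heq | hlt
  · have := hE.right_le_left hu hlt ht
    rw [h] at this; linarith
  · exact heq
  · have := hE.right_le_left hu hlt hs
    rw [h] at this; linarith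

namespace TwoChains

variable {a b : ℕ} {u l : ℕ → V}

/-- Membership in one of the two chains. -/
def On (a b : ℕ) (u l : ℕ → V) (i : V) : Prop := (∃ j ≤ a + 1, u j = i) ∨ ∃ j ≤ b + 1, l j = i

theorem symm (h : TwoChains E a b u l) : TwoChains E b a l u where
  first := h.first.symm
  last := h.last.symm
  contact_u := h.contact_l
  contact_l := h.contact_u
  disj s t h1 h2 h3 h4 := (h.disj t s h3 h4 h1 h2).symm
  nondeg := by have := h.nondeg; omega
  off_unique i i' h1 h2 h3 h4 := h.off_unique i i' h2 h1 h4 h3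

theorem off_subsingleton (h : TwoChains E a b u l) {i i' : V} (hi : ¬ On a b u l i)
    (hi' : ¬ On a b u l i') : i = i' := by
  unfold On at hi hi'
  push Not at hi hi'
  exact h.off_unique i i' hi.1 hi.2 hi'.1 hi'.2

theorem first_on : On a b u l (u 0) := Or.inl ⟨0, by omega, rfl⟩

theorem last_on : On a b u l (u (a + 1)) := Or.inl ⟨a + 1, le_rfl, rfl⟩

/-- If the first and last intervals touched directly, no room would be left for the interior members
of the other chain, which exist by `nondeg`. -/
theorem pos_left (h : TwoChains E a b u l) (hE : SideContact x r E) : 0 < a := by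
  by_contra ha
  obtain rfl : a = 0 := by omega
  have hb := h.nondeg
  have h1 := hE.gap _ _ (h.contact_u 0 le_rfl)
  have h2 := hE.right_le_left h.contact_l (show 0 < 1 by omega) (by omega)
  have h3 := hE.right_le_left h.contact_l (show 1 < b + 1 by omega) le_rfl
  have := hE.pos (l 1)
  rw [h.first, h.last] at h1
  linarith

theorem pos_right (h : TwoChains E a b u l) (hE : SideContact x r E) : 0 < b :=
  h.symm.pos_left hE

theorem first_le_left (h : TwoChains E a b u l) (hE : SideContact x r E) {i : V}
    (hi : On a b u l i) : i = u 0 ∨ x (u 0) + r (u 0) ≤ x i - r i := by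
  rcases hi with ⟨j, hj, rfl⟩ | ⟨j, hj, rfl⟩
  · rcases Nat.eq_zero_or_pos j with rfl | h0
    · exact Or.inl rfl
    · exact Or.inr (hE.right_le_left h.contact_u h0 hj)
  · rw [h.first]
    rcases Nat.eq_zero_or_pos j with rfl | h0
    · exact Or.inl rfl
    · exact Or.inr (hE.right_le_left h.contact_l h0 hj)

theorem right_le_last (h : TwoChains E a b u l) (hE : SideContact x r E) {i : V}
    (hi : On a b u l i) :
    i = u (a + 1) ∨ x i + r i ≤ x (u (a + 1)) - r (u (a + 1)) := by
  rcases hi with ⟨j, hj, rfl⟩ | ⟨j, hj, rfl⟩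
  · rcases hj.eq_or_lt with rfl | h0
    · exact Or.inl rfl
    · exact Or.inr (hE.right_le_left h.contact_u h0 le_rfl)
  · rw [h.last]
    rcases hj.eq_or_lt with rfl | h0
    · exact Or.inl rfl
    · exact Or.inr (hE.right_le_left h.contact_l h0 le_rfl)

theorem first_ne_last (h : TwoChains E a b u l) (hE : SideContact x r E) : u 0 ≠ u (a + 1) :=
  fun h' => by
    have := hE.chain_injective h.contact_u (by omega) (by omega) h'
    omega

/-- Interior break points of the two chains are distinct. -/
theorem break_points [Fintype V] (h : TwoChains E a b u l) (hE : SideContact x r E)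
    (hg : FewZeroSigns r) {s t : ℕ} (hs1 : 1 ≤ s) (hsa : s ≤ a) (ht1 : 1 ≤ t) (htb : t ≤ b)
    (heq : x (u s) + r (u s) = x (l t) + r (l t)) : s = a ∧ t = b := by
  classical
  by_contra hne
  -- If one chain has reached the left end of the last interval, the other must have reached it too;
  -- so both indices lie strictly before the end.
  have hsa' : s < a := by
    refine lt_of_le_of_ne hsa fun hs => ?_
    have ht : t < b := lt_of_le_of_ne htb fun ht => hne ⟨hs, ht⟩
    have h1 := hE.gap _ _ (h.contact_u a le_rfl)
    have h2 := hE.right_le_left h.contact_l ht (by omega)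
    have h3 := hE.right_le_left h.contact_l (show b < b + 1 by omega) le_rfl
    have := hE.pos (l b)
    rw [h.last] at h1
    subst hs
    linarith
  have htb' : t < b := by
    refine lt_of_le_of_ne htb fun ht => ?_
    have h1 := hE.gap _ _ (h.contact_l b le_rfl)
    have h2 := hE.right_le_left h.contact_u hsa' (by omega)
    have h3 := hE.right_le_left h.contact_u (show a < a + 1 by omega) le_rfl
    have := hE.pos (u a)
    rw [← h.last] at h1
    subst ht
    linarith
  have iu : ∀ {s t}, s ≤ a + 1 → t ≤ a + 1 → u s = u t → s = t := hE.chain_injective h.contact_u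
  have il : ∀ {s t}, s ≤ b + 1 → t ≤ b + 1 → l s = l t → s = t := hE.chain_injective h.contact_l
  set A := (Finset.range s).image (fun j => u (j + 1)) with hA
  set B := (Finset.range t).image (fun j => l (j + 1)) with hB
  have sumA : ∑ i ∈ A, r i = ∑ j ∈ Finset.range s, r (u (j + 1)) :=
    Finset.sum_image fun i hi j hj hij => by
      have := Finset.mem_range.1 hi
      have := Finset.mem_range.1 hj
      have := iu (by omega) (by omega) hij
      omega
  have sumB : ∑ i ∈ B, r i = ∑ j ∈ Finset.range t, r (l (j + 1)) :=
    Finset.sum_image fun i hi j hj hij => by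
      have := Finset.mem_range.1 hi
      have := Finset.mem_range.1 hj
      have := il (by omega) (by omega) hij
      omega
  have hAB : ∑ i ∈ A, r i = ∑ i ∈ B, r i := by
    have h1 := hE.right_eq_sum h.contact_u (s := s) (by omega)
    have h2 := hE.right_eq_sum h.contact_l (s := t) (by omega)
    rw [h.first] at h1
    rw [sumA, sumB]
    linarith
  have uA : ∀ j ≤ a + 1, (j = 0 ∨ s < j) → u j ∉ A := fun j hj hj' hm => by
    obtain ⟨c, hc, hcj⟩ := Finset.mem_image.1 hm
    have := Finset.mem_range.1 hc
    have := iu (by omega) hj hcj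
    omega
  have lB : ∀ j ≤ b + 1, (j = 0 ∨ t < j) → l j ∉ B := fun j hj hj' hm => by
    obtain ⟨c, hc, hcj⟩ := Finset.mem_image.1 hm
    have := Finset.mem_range.1 hc
    have := il (by omega) hj hcj
    omega
  have uB : ∀ j, 1 ≤ j → j ≤ a → u j ∉ B := fun j h1 h2 hm => by
    obtain ⟨c, hc, hcj⟩ := Finset.mem_image.1 hm
    have := Finset.mem_range.1 hc
    exact h.disj j (c + 1) h1 h2 (by omega) (by omega) hcj.symm
  have lA : ∀ j, 1 ≤ j → j ≤ b → l j ∉ A := fun j h1 h2 hm => by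
    obtain ⟨c, hc, hcj⟩ := Finset.mem_image.1 hm
    have := Finset.mem_range.1 hc
    exact h.disj (c + 1) j (by omega) (by omega) h1 h2 hcj
  -- The two partial sums start after the first interval and stop before `u a` and `l b`, so these
  -- four members carry sign zero in their difference.
  have hcard : ({u 0, u (a + 1), u a, l b} : Finset V).card = 4 := by
    have e1 : u 0 ≠ u (a + 1) := fun h => by have := iu (by omega) (by omega) h; omega
    have e2 : u 0 ≠ u a := fun h => by have := iu (by omega) (by omega) h; omega
    have e3 : u (a + 1) ≠ u a := fun h => by have := iu (by omega) (by omega) h; omega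
    have e4 : u 0 ≠ l b := fun h' => by
      have := il (by omega) (by omega) (h.first.symm.trans h'); omega
    have e5 : u (a + 1) ≠ l b := fun h' => by
      have := il (by omega) (by omega) (h.last.symm.trans h'); omega
    rw [Finset.card_insert_of_notMem, Finset.card_insert_of_notMem,
      Finset.card_pair (h.disj a b (by omega) le_rfl (by omega) le_rfl)] <;> simp [*]
  have := hg (fun i => (if i ∈ A then 1 else 0) - if i ∈ B then 1 else 0)
    (fun i => by split_ifs <;> simp)
    (by simp [sub_mul, Finset.sum_sub_distrib, hAB])
    {u 0, u (a + 1), u a, l b} hcard.ge (by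
      intro i hi
      simp only [Finset.mem_insert, Finset.mem_singleton] at hi
      rcases hi with rfl | rfl | rfl | rfl
      · rw [if_neg (uA 0 (by omega) (by omega)), h.first, if_neg (lB 0 (by omega) (by omega)),
          sub_zero]
      · rw [if_neg (uA _ le_rfl (by omega)), h.last, if_neg (lB _ le_rfl (by omega)), sub_zero]
      · rw [if_neg (uA _ (by omega) (by omega)), if_neg (uB _ (by omega) le_rfl), sub_zero]
      · rw [if_neg (lA _ (by omega) le_rfl), if_neg (lB _ (by omega) (by omega)), sub_zero])
    (u 1)
  rw [if_neg (uB 1 le_rfl (by omega)),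
    if_pos (Finset.mem_image.2 ⟨0, Finset.mem_range.2 (by omega), rfl⟩)] at this
  norm_num at this

/-- Right ends increase strictly along each chain, and `break_points` rules out coincidences across
the chains, except for the two members that both touch the last interval. -/
theorem eq_or_of_right_eq [Fintype V] (h : TwoChains E a b u l) (hE : SideContact x r E)
    (hg : FewZeroSigns r) {i i' : V} (hi : On a b u l i) (hi' : On a b u l i')
    (heq : x i + r i = x i' + r i') :
    i = i' ∨ (i = u a ∧ i' = l b) ∨ (i = l b ∧ i' = u a) := by
  have same : ∀ {a : ℕ} {u : ℕ → V} (_ : ∀ j ≤ a, E (u j) (u (j + 1))) {s t : ℕ}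
      (_ : s ≤ a + 1) (_ : t ≤ a + 1), x (u s) + r (u s) = x (u t) + r (u t) → u s = u t := by
    intro a u hu s t hs ht h
    rcases lt_trichotomy s t with hlt | heq | hlt
    · have := hE.right_le_left hu hlt ht
      have := hE.pos (u t)
      linarith
    · rw [heq]
    · have := hE.right_le_left hu hlt hs
      have := hE.pos (u s)
      linarith
  have mixed : ∀ s t, s ≤ a + 1 → t ≤ b + 1 → x (u s) + r (u s) = x (l t) + r (l t) →
      u s = l t ∨ (u s = u a ∧ l t = l b) := by
    intro s t hs ht hst
    rcases Nat.eq_zero_or_pos s with rfl | hs0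
    · left
      rw [h.first] at hst ⊢
      exact same h.contact_l (by omega) ht hst
    rcases hs.eq_or_lt with rfl | hs1
    · left
      rw [h.last] at hst ⊢
      exact same h.contact_l le_rfl ht hst
    rcases Nat.eq_zero_or_pos t with rfl | ht0
    · left
      rw [← h.first] at hst ⊢
      exact same h.contact_u hs (by omega) hst
    rcases ht.eq_or_lt with rfl | ht1
    · left
      rw [← h.last] at hst ⊢
      exact same h.contact_u hs le_rfl hst
    obtain ⟨rfl, rfl⟩ := h.break_points hE hg hs0 (by omega) ht0 (by omega) hst
    exact Or.inr ⟨rfl, rfl⟩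
  rcases hi with ⟨s, hs, rfl⟩ | ⟨s, hs, rfl⟩ <;> rcases hi' with ⟨t, ht, rfl⟩ | ⟨t, ht, rfl⟩
  · exact Or.inl (same h.contact_u hs ht heq)
  · exact (mixed s t hs ht heq).imp id Or.inl
  · rcases mixed t s ht hs heq.symm with h1 | ⟨h1, h2⟩
    · exact Or.inl h1.symm
    · exact Or.inr (Or.inr ⟨h2, h1⟩)
  · exact Or.inl (same h.contact_l hs ht heq)

/-- The left end of a member other than the first is the right end of its predecessor, so this
reduces to `eq_or_of_right_eq`. A common predecessor has two successors only if it is the first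
interval. -/
theorem eq_or_of_left_eq [Fintype V] (h : TwoChains E a b u l) (hE : SideContact x r E)
    (hg : FewZeroSigns r) {i i' : V} (hi : On a b u l i) (hi' : On a b u l i')
    (heq : x i - r i = x i' - r i') :
    i = i' ∨ (i = u 1 ∧ i' = l 1) ∨ (i = l 1 ∧ i' = u 1) := by
  have ha := h.pos_left hE
  have hb := h.pos_right hE
  have iu : ∀ {s t}, s ≤ a + 1 → t ≤ a + 1 → u s = u t → s = t := hE.chain_injective h.contact_u
  have il : ∀ {s t}, s ≤ b + 1 → t ≤ b + 1 → l s = l t → s = t := hE.chain_injective h.contact_l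
  have pred : ∀ i, On a b u l i → i = u 0 ∨ (∃ s ≤ a, i = u (s + 1)) ∨ ∃ s ≤ b, i = l (s + 1) := by
    rintro i (⟨j, hj, rfl⟩ | ⟨j, hj, rfl⟩)
    · rcases j with _ | j
      · exact Or.inl rfl
      · exact Or.inr (Or.inl ⟨j, by omega, rfl⟩)
    · rcases j with _ | j
      · exact Or.inl h.first.symm
      · exact Or.inr (Or.inr ⟨j, by omega, rfl⟩)
  have hu : ∀ s ≤ a, x (u (s + 1)) - r (u (s + 1)) = x (u s) + r (u s) := fun s hs => by
    have := hE.gap _ _ (h.contact_u s hs); linarith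
  have hl : ∀ s ≤ b, x (l (s + 1)) - r (l (s + 1)) = x (l s) + r (l s) := fun s hs => by
    have := hE.gap _ _ (h.contact_l s hs); linarith
  have onu : ∀ s ≤ a, On a b u l (u s) := fun s hs => Or.inl ⟨s, by omega, rfl⟩
  have onl : ∀ s ≤ b, On a b u l (l s) := fun s hs => Or.inr ⟨s, by omega, rfl⟩
  have hfirst : ∀ i, On a b u l i → x i - r i = x (u 0) - r (u 0) → i = u 0 := fun i hi h' =>
    (h.first_le_left hE hi).resolve_right fun h2 => by
      have := hE.pos (u 0); linarith
  have mixed : ∀ s t, s ≤ a → t ≤ b → x (u (s + 1)) - r (u (s + 1)) = x (l (t + 1)) - r (l (t + 1)) →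
      u (s + 1) = l (t + 1) ∨ (s = 0 ∧ t = 0) := by
    intro s t hs ht hst
    rw [hu s hs, hl t ht] at hst
    rcases h.eq_or_of_right_eq hE hg (onu s hs) (onl t ht) hst with h1 | ⟨h1, h2⟩ | ⟨h1, h2⟩
    · right
      rcases Nat.eq_zero_or_pos s with rfl | hs0
      · rw [h.first] at h1
        exact ⟨rfl, (il (by omega) (by omega) h1).symm⟩
      · rcases Nat.eq_zero_or_pos t with rfl | ht0
        · rw [← h.first] at h1
          exact ⟨iu (by omega) (by omega) h1, rfl⟩
        · exact absurd h1 (h.disj s t hs0 hs ht0 ht)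
    · left
      rw [iu (by omega) (by omega) h1, il (by omega) (by omega) h2, h.last]
    · exfalso
      rcases Nat.eq_zero_or_pos s with rfl | hs0
      · rw [h.first] at h1
        have := il (by omega) (by omega) h1
        omega
      · exact h.disj s b hs0 hs hb le_rfl h1
  rcases pred i hi with rfl | ⟨s, hs, rfl⟩ | ⟨s, hs, rfl⟩
  · exact Or.inl (hfirst i' hi' heq.symm).symm
  · rcases pred i' hi' with rfl | ⟨t, ht, rfl⟩ | ⟨t, ht, rfl⟩
    · exact Or.inl (hfirst _ hi heq)
    · rw [hu s hs, hu t ht] at heq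
      rcases h.eq_or_of_right_eq hE hg (onu s hs) (onu t ht) heq with h1 | ⟨h1, h2⟩ | ⟨h1, h2⟩
      · rw [iu (by omega) (by omega) h1]; exact Or.inl rfl
      · exfalso
        rcases Nat.eq_zero_or_pos t with rfl | h0
        · rw [h.first] at h2
          have := il (by omega) (by omega) h2; omega
        · exact h.disj _ _ h0 ht hb le_rfl h2
      · exfalso
        rcases Nat.eq_zero_or_pos s with rfl | h0
        · rw [h.first] at h1
          have := il (by omega) (by omega) h1; omega
        · exact h.disj _ _ h0 hs hb le_rfl h1
    · rcases mixed s t hs ht heq with h1 | ⟨rfl, rfl⟩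
      · exact Or.inl h1
      · exact Or.inr (Or.inl ⟨rfl, rfl⟩)
  · rcases pred i' hi' with rfl | ⟨t, ht, rfl⟩ | ⟨t, ht, rfl⟩
    · exact Or.inl (hfirst _ hi heq)
    · rcases mixed t s ht hs heq.symm with h1 | ⟨rfl, rfl⟩
      · exact Or.inl h1.symm
      · exact Or.inr (Or.inr ⟨rfl, rfl⟩)
    · rw [hl s hs, hl t ht] at heq
      rcases h.eq_or_of_right_eq hE hg (onl s hs) (onl t ht) heq with h1 | ⟨h1, h2⟩ | ⟨h1, h2⟩
      · rw [il (by omega) (by omega) h1]; exact Or.inl rfl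
      · exfalso
        rcases Nat.eq_zero_or_pos s with rfl | h0
        · rw [← h.first] at h1
          have := iu (by omega) (by omega) h1; omega
        · exact h.disj _ _ ha le_rfl h0 hs h1.symm
      · exfalso
        rcases Nat.eq_zero_or_pos t with rfl | h0
        · rw [← h.first] at h2
          have := iu (by omega) (by omega) h2; omega
        · exact h.disj _ _ ha le_rfl h0 ht h2.symm

end TwoChains

end

/-! ### Counting contacts in two directions -/

/-- The number of ordered pairs related by `E`. -/
noncomputable def pairCount {V : Type*} (E : V → V → Prop) : ℕ := {p : V × V | E p.1 p.2}.ncard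

theorem pairCount_add_one_le_of_isAcyclic {V : Type*} [Fintype V] [Nonempty V] {E : V → V → Prop}
    (hE : ∀ i j, E i j → ¬ E j i) (h : (SimpleGraph.fromRel E).IsAcyclic) :
    pairCount E + 1 ≤ Fintype.card V := by
  refine le_trans (Nat.add_le_add_right ?_ 1) h.ncard_edgeSet_lt
  refine Set.ncard_le_ncard_of_injOn (fun p => s(p.1, p.2)) ?_ ?_ (Set.toFinite _)
  · rintro ⟨i, j⟩ hij
    rw [SimpleGraph.mem_edgeSet, SimpleGraph.fromRel_adj]
    exact ⟨fun h : i = j => hE i j hij (by subst h; exact hij), Or.inl hij⟩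
  · rintro ⟨i, j⟩ hij ⟨i', j'⟩ hij' h
    rcases Sym2.eq_iff.1 h with ⟨h1, h2⟩ | ⟨h1, h2⟩
    · exact Prod.ext h1 h2
    · dsimp only at h1 h2
      subst h1 h2
      exact absurd hij' (hE _ _ hij)

section

variable {V : Type*} [Fintype V] {x y r : V → ℝ} {E F : V → V → Prop}

theorem SideContact.asymm {V : Type*} {x r : V → ℝ} {E : V → V → Prop} (hE : SideContact x r E)
    (i j : V) (h : E i j) : ¬ E j i := fun h' => by
  have := hE.gap _ _ h
  have := hE.gap _ _ h'
  have := hE.pos i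
  have := hE.pos j
  linarith

/-- Used to refute a cycle in the second direction: missing at most one square, it would give two
neighbours to one of any two given squares. -/
theorem SideContact.exists_large_core (hE : SideContact x r E) (hg : FewZeroSigns r)
    (hc : ¬ (SimpleGraph.fromRel E).IsAcyclic) :
    ∃ S : Set V, (∀ i i', i ∉ S → i' ∉ S → i = i') ∧
      ∀ i ∈ S, ∃ j j', j ≠ j' ∧ (E i j ∨ E j i) ∧ (E i j' ∨ E j' i) := by
  obtain ⟨k, p, f, hk, hp0, hpk, hper, hinj, hup, hdown, hoff⟩ := hE.exists_monotone_cycle hg hc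
  have hadj : ∀ j, E (f j) (f (j + 1)) ∨ E (f (j + 1)) (f j) := by
    intro j
    have h1 : f (j % k) = f j := Function.Periodic.map_mod_nat hper j
    have h2 : f (j % k + 1) = f (j + 1) := by
      have := Function.Periodic.map_mod_nat (f := fun j => f (j + 1)) (a := k)
        (fun j => by dsimp only; rw [show j + k + 1 = j + 1 + k by omega, hper]) j
      exact this
    rw [← h1, ← h2]
    have hlt := Nat.mod_lt j (show 0 < k by omega)
    rcases lt_or_ge (j % k) p with h | h
    · exact Or.inl (hup _ h)
    · exact Or.inr (hdown _ h hlt)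
  refine ⟨Set.range f, fun i i' hi hi' => hoff i i' (fun j hj => hi ⟨j, hj⟩)
    (fun j hj => hi' ⟨j, hj⟩), ?_⟩
  rintro _ ⟨j, rfl⟩
  refine ⟨f (j + 1), f (j + k - 1), fun h => Nat.not_modEq_of_lt (by omega) (by omega) (hinj _ _ h),
    hadj j, ?_⟩
  have := hadj (j + k - 1)
  rw [show j + k - 1 + 1 = j + k by omega, hper] at this
  exact this.symm

namespace TwoChains

variable {a b : ℕ} {u l : ℕ → V}

/-- There are at most as many contacts among the chain members as there are members. -/
theorem ncard_contacts_on_le (h : TwoChains E a b u l) (hE : SideContact x r E)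
    (hg : FewZeroSigns r) :
    {p : V × V | On a b u l p.1 ∧ On a b u l p.2 ∧ E p.1 p.2}.ncard ≤
      {i | On a b u l i}.ncard := by
  classical
  have hb := h.pos_right hE
  have hnoleft : ∀ i, On a b u l i → ¬ E i (u 0) := fun i hi hE0 => by
    have h1 := hE.gap _ _ hE0
    have := hE.pos i
    have := hE.pos (u 0)
    rcases h.first_le_left hE hi with rfl | h2
    · linarith
    · linarith
  have hfar : ∀ j, On a b u l j → E (u a) j → j = u (a + 1) := fun j hj hEj => by
    refine (h.right_le_last hE hj).resolve_right fun h2 => ?_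
    have h1 := hE.gap _ _ hEj
    have h3 := hE.gap _ _ (h.contact_u a le_rfl)
    have := hE.pos j
    linarith
  have hright : x (u a) + r (u a) = x (l b) + r (l b) := by
    have h1 := hE.gap _ _ (h.contact_u a le_rfl)
    have h2 := hE.gap _ _ (h.contact_l b le_rfl)
    rw [h.last] at h1
    linarith
  -- Each contact is sent to its right-hand member. Only the last interval can be hit twice, from `u
  -- a` and `l b`; the second of these contacts is sent instead to `u 0`, which is never a
  -- right-hand member.
  refine Set.ncard_le_ncard_of_injOn
    (fun p => if p = (l b, u (a + 1)) then u 0 else p.2) ?_ ?_ (Set.toFinite _)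
  · rintro p ⟨h1, h2, -⟩
    split_ifs
    · exact first_on
    · exact h2
  · rintro ⟨i, j⟩ ⟨h1, h2, h3⟩ ⟨i', j'⟩ ⟨h1', h2', h3'⟩ heq
    have main : ∀ {i i' j : V}, On a b u l i → On a b u l i' → On a b u l j → E i j → E i' j →
        (i, j) ≠ (l b, u (a + 1)) → (i', j) ≠ (l b, u (a + 1)) → i = i' := by
      intro i i' j hi hi' hj h3 h3' hn hn'
      have g1 := hE.gap _ _ h3
      have g2 := hE.gap _ _ h3'
      rcases h.eq_or_of_right_eq hE hg hi hi' (by linarith) with h4 | ⟨rfl, rfl⟩ | ⟨rfl, rfl⟩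
      · exact h4
      · exact absurd (by rw [hfar j hj h3]) hn'
      · exact absurd (by rw [hfar j hj h3']) hn
    dsimp only at h1 h2 h3 h1' h2' h3' heq
    split_ifs at heq with hc hc' hc'
    · exact hc.trans hc'.symm
    · exact absurd (heq ▸ h3') (hnoleft _ h1')
    · exact absurd (heq.symm ▸ h3) (hnoleft _ h1)
    · subst heq
      rw [main h1 h1' h2 h3 h3' hc hc']

/-- Two left neighbours of `w` have equal right ends, so they are `u a` and `l b`. With `w` and the
last interval they would form a four-cycle along one line, against `no_core`. -/
theorem subsingleton_left_contacts (h : TwoChains E a b u l) (hE : SideContact x r E)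
    (hg : FewZeroSigns r) {w : V} (hw : ¬ On a b u l w) : {i | E i w}.Subsingleton := by
  classical
  have hb := h.pos_right hE
  have ha := h.pos_left hE
  have hon : ∀ i, E i w → On a b u l i := fun i hi => by
    by_contra hn
    rw [h.off_subsingleton hn hw] at hi
    exact hE.asymm _ _ hi hi
  have key : E (u a) w → E (l b) w → False := by
    intro h1 h2
    have hwl : w ≠ u (a + 1) := fun h => hw (h ▸ last_on)
    have hul : u a ≠ l b := h.disj a b ha le_rfl hb le_rfl
    have g1 := hE.gap _ _ h1
    have g2 := hE.gap _ _ h2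
    have c1 := h.contact_u a le_rfl
    have c2 := h.contact_l b le_rfl
    rw [← h.last] at c2
    have g3 := hE.gap _ _ c1
    refine hE.no_core {u a, l b, w, u (a + 1)} (x (u a) + r (u a)) ⟨u a, by simp⟩ ?_
    intro i hi
    simp only [Finset.mem_insert, Finset.mem_singleton] at hi
    rcases hi with rfl | rfl | rfl | rfl
    · exact Or.inl ⟨rfl, w, by simp, u (a + 1), by simp, hwl, h1, c1⟩
    · exact Or.inl ⟨by linarith, w, by simp, u (a + 1), by simp, hwl, h2, c2⟩
    · exact Or.inr ⟨by linarith, u a, by simp, l b, by simp, hul, h1, h2⟩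
    · exact Or.inr ⟨by linarith, u a, by simp, l b, by simp, hul, c1, c2⟩
  intro i hi i' hi'
  have g1 := hE.gap _ _ hi
  have g2 := hE.gap _ _ hi'
  rcases h.eq_or_of_right_eq hE hg (hon i hi) (hon i' hi') (by linarith) with
    h4 | ⟨rfl, rfl⟩ | ⟨rfl, rfl⟩
  · exact h4
  · exact (key hi hi').elim
  · exact (key hi' hi).elim

/-- Mirror image of `subsingleton_left_contacts`: the four-cycle consists of `u 1`, `l 1`, `w` and
the first interval. -/
theorem subsingleton_right_contacts (h : TwoChains E a b u l) (hE : SideContact x r E)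
    (hg : FewZeroSigns r) {w : V} (hw : ¬ On a b u l w) : {i | E w i}.Subsingleton := by
  classical
  have hb := h.pos_right hE
  have ha := h.pos_left hE
  have hon : ∀ i, E w i → On a b u l i := fun i hi => by
    by_contra hn
    rw [h.off_subsingleton hn hw] at hi
    exact hE.asymm _ _ hi hi
  have key : E w (u 1) → E w (l 1) → False := by
    intro h1 h2
    have hwl : w ≠ u 0 := fun h => hw (h ▸ first_on)
    have hul : u 1 ≠ l 1 := h.disj 1 1 le_rfl ha le_rfl hb
    have g1 := hE.gap _ _ h1
    have g2 := hE.gap _ _ h2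
    have c1 : E (u 0) (u 1) := h.contact_u 0 (by omega)
    have c2 : E (l 0) (l 1) := h.contact_l 0 (by omega)
    rw [← h.first] at c2
    have g3 := hE.gap _ _ c1
    refine hE.no_core {u 1, l 1, w, u 0} (x (u 1) - r (u 1)) ⟨u 1, by simp⟩ ?_
    intro i hi
    simp only [Finset.mem_insert, Finset.mem_singleton] at hi
    rcases hi with rfl | rfl | rfl | rfl
    · exact Or.inr ⟨rfl, w, by simp, u 0, by simp, hwl, h1, c1⟩
    · exact Or.inr ⟨by linarith, w, by simp, u 0, by simp, hwl, h2, c2⟩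
    · exact Or.inl ⟨by linarith, u 1, by simp, l 1, by simp, hul, h1, h2⟩
    · exact Or.inl ⟨by linarith, u 1, by simp, l 1, by simp, hul, c1, c2⟩
  intro i hi i' hi'
  have g1 := hE.gap _ _ hi
  have g2 := hE.gap _ _ hi'
  rcases h.eq_or_of_left_eq hE hg (hon i hi) (hon i' hi') (by linarith) with
    h4 | ⟨rfl, rfl⟩ | ⟨rfl, rfl⟩
  · exact h4
  · exact (key hi hi').elim
  · exact (key hi' hi).elim

end TwoChains

theorem ncard_add_ncard_le_one {α β : Type*} [Finite α] [Finite β] {s : Set α} {t : Set β} (hs : s.Subsingleton)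
    (ht : t.Subsingleton) (h : s.Nonempty → ¬ t.Nonempty) : s.ncard + t.ncard ≤ 1 := by
  rcases s.eq_empty_or_nonempty with rfl | hne
  · simpa using (Set.ncard_le_one (Set.toFinite _)).2 fun _ ha _ hb => ht ha hb
  · rw [Set.not_nonempty_iff_eq_empty.1 (h hne)]
    simpa using (Set.ncard_le_one (Set.toFinite _)).2 fun _ ha _ hb => hs ha hb

/-- If the contacts in one direction contain a cycle, both directions together have at most
`2n - 2` contacts. -/
theorem SideContact.pairCount_add_le_of_cycle (hE : SideContact x r E) (hF : SideContact y r F)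
    (hg : FewZeroSigns r) (hFx : ∀ i j, F i j → |x i - x j| < r i + r j)
    (hc : ¬ (SimpleGraph.fromRel E).IsAcyclic) :
    pairCount E + pairCount F + 2 ≤ 2 * Fintype.card V := by
  classical
  obtain ⟨a, b, u, l, h⟩ := hE.exists_twoChains hg hc
  have ha := h.pos_left hE
  obtain ⟨z, hz⟩ : ∃ z, u 0 = z := ⟨_, rfl⟩
  obtain ⟨z', hz'⟩ : ∃ z, u (a + 1) = z := ⟨_, rfl⟩
  have hzz : z ≠ z' := by rw [← hz, ← hz']; exact h.first_ne_last hE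
  have hFadj : ∀ i j, F i j ∨ F j i → i ≠ j ∧ |x i - x j| < r i + r j := by
    rintro i j (hij | hij)
    · refine ⟨?_, hFx i j hij⟩
      rintro rfl
      exact hF.asymm _ _ hij hij
    · refine ⟨?_, by rw [abs_sub_comm, add_comm]; exact hFx j i hij⟩
      rintro rfl
      exact hF.asymm _ _ hij hij
  -- An `F`-contact requires strictly overlapping `x`-ranges, but every other chain member starts at
  -- or beyond the right end of `z`.
  have hzoff : ∀ i, F z i ∨ F i z → ¬ TwoChains.On a b u l i := by
    intro i hi hon
    obtain ⟨h1, h2⟩ := hFadj z i hi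
    rcases h.first_le_left hE hon with h3 | h3
    · exact h1 (by rw [h3, hz])
    · rw [hz] at h3
      have := (abs_lt.1 h2).1
      linarith
  have hzoff' : ∀ i, F z' i ∨ F i z' → ¬ TwoChains.On a b u l i := by
    intro i hi hon
    obtain ⟨h1, h2⟩ := hFadj z' i hi
    rcases h.right_le_last hE hon with h3 | h3
    · exact h1 (by rw [h3, hz'])
    · rw [hz'] at h3
      have := (abs_lt.1 h2).2
      linarith
  -- A cycle in `F` would pass through `z` or `z'`, giving it two distinct neighbours off the
  -- chains; at most one square is off them.
  have hFac : (SimpleGraph.fromRel F).IsAcyclic := by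
    by_contra hFc
    obtain ⟨S, hS1, hS2⟩ := hF.exists_large_core hg hFc
    by_cases hzS : z ∈ S
    · obtain ⟨j, j', hjj, h1, h2⟩ := hS2 z hzS
      exact hjj (h.off_subsingleton (hzoff j h1) (hzoff j' h2))
    · by_cases hzS' : z' ∈ S
      · obtain ⟨j, j', hjj, h1, h2⟩ := hS2 z' hzS'
        exact hjj (h.off_subsingleton (hzoff' j h1) (hzoff' j' h2))
      · exact hzz (hS1 _ _ hzS hzS')
  -- Without `z` and `z'` a forest on two fewer vertices remains, nonempty since it contains `u 1`;
  -- hence the 3.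
  have hcoreF : {p : V × V | F p.1 p.2 ∧ (p.1 ≠ z ∧ p.1 ≠ z') ∧ (p.2 ≠ z ∧ p.2 ≠ z')}.ncard + 3 ≤
      Fintype.card V := by
    have hne : Nonempty {i // i ≠ z ∧ i ≠ z'} := ⟨u 1, by
      rw [← hz, ← hz']
      constructor <;> intro h'
      · have := hE.chain_injective h.contact_u (by omega) (by omega) h'
        omega
      · have := hE.chain_injective h.contact_u (by omega) (by omega) h'
        omega⟩
    have hac : (SimpleGraph.fromRel fun i j : {i // i ≠ z ∧ i ≠ z'} => F i j).IsAcyclic :=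
      hFac.comap (G := SimpleGraph.fromRel fun i j : {i // i ≠ z ∧ i ≠ z'} => F i j)
        ⟨Subtype.val, fun {i j} hij => by
          rw [SimpleGraph.fromRel_adj] at hij ⊢
          exact ⟨fun h => hij.1 (Subtype.ext h), hij.2⟩⟩ Subtype.val_injective
    have h1 := pairCount_add_one_le_of_isAcyclic
      (E := fun i j : {i // i ≠ z ∧ i ≠ z'} => F i j) (fun i j h => hF.asymm i j h) hac
    have h2 : Fintype.card {i // i ≠ z ∧ i ≠ z'} + 2 = Fintype.card V := by
      have h3 : (Finset.univ.filter fun i => i ≠ z ∧ i ≠ z') = Finset.univ \ {z, z'} := by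
        ext i; simp
      have h4 := Finset.card_sdiff_add_card_eq_card (Finset.subset_univ ({z, z'} : Finset V))
      rw [Finset.card_pair hzz] at h4
      rw [Fintype.card_subtype, h3, h4, Finset.card_univ]
    have h3 : {p : V × V | F p.1 p.2 ∧ (p.1 ≠ z ∧ p.1 ≠ z') ∧ (p.2 ≠ z ∧ p.2 ≠ z')}.ncard ≤
        pairCount fun i j : {i // i ≠ z ∧ i ≠ z'} => F i j := by
      unfold pairCount
      rw [← Set.ncard_image_of_injective _
        (Prod.map_injective.2 ⟨Subtype.val_injective, Subtype.val_injective⟩)]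
      refine Set.ncard_le_ncard ?_ (Set.toFinite _)
      rintro ⟨i, j⟩ ⟨hij, hi, hj⟩
      exact ⟨(⟨i, hi⟩, ⟨j, hj⟩), hij, rfl⟩
    omega
  have hEon := h.ncard_contacts_on_le hE hg
  by_cases hall : ∀ i, TwoChains.On a b u l i
  · have h1 : pairCount E ≤ Fintype.card V := by
      refine le_trans ?_ (hEon.trans ?_)
      · exact Set.ncard_le_ncard (fun p hp => ⟨hall _, hall _, hp⟩) (Set.toFinite _)
      · rw [← Nat.card_eq_fintype_card]
        exact Set.ncard_le_card _
    have h2 : pairCount F + 3 ≤ Fintype.card V := by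
      refine le_trans (Nat.add_le_add_right ?_ 3) hcoreF
      refine Set.ncard_le_ncard (fun p hp => ⟨hp, ⟨?_, ?_⟩, ⟨?_, ?_⟩⟩) (Set.toFinite _)
      · intro h'; exact hzoff p.2 (Or.inl (h' ▸ hp)) (hall _)
      · intro h'; exact hzoff' p.2 (Or.inl (h' ▸ hp)) (hall _)
      · intro h'; exact hzoff p.1 (Or.inr (h' ▸ hp)) (hall _)
      · intro h'; exact hzoff' p.1 (Or.inr (h' ▸ hp)) (hall _)
    omega
  · push Not at hall
    obtain ⟨w, hw⟩ := hall
    have honw : ∀ i, i ≠ w → TwoChains.On a b u l i := fun i hi => by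
      by_contra hn
      exact hi (h.off_subsingleton hn hw)
    have hEw : ¬ E w w := fun h' => hE.asymm _ _ h' h'
    have h1 : pairCount E ≤ {p : V × V | TwoChains.On a b u l p.1 ∧ TwoChains.On a b u l p.2 ∧
        E p.1 p.2}.ncard + {i | E i w}.ncard + {i | E w i}.ncard := by
      rw [← Set.ncard_image_of_injective {i | E i w} (Prod.mk_left_injective w),
        ← Set.ncard_image_of_injective {i | E w i} (Prod.mk_right_injective w)]
      refine le_trans (Set.ncard_le_ncard ?_ (Set.toFinite _))
        ((Set.ncard_union_le _ _).trans (Nat.add_le_add_right (Set.ncard_union_le _ _) _))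
      rintro ⟨i, j⟩ hij
      by_cases hj : j = w
      · subst hj
        exact Or.inl (Or.inr ⟨i, hij, rfl⟩)
      · by_cases hi : i = w
        · subst hi
          exact Or.inr ⟨j, hij, rfl⟩
        · exact Or.inl (Or.inl ⟨honw i hi, honw j hj, hij⟩)
    have h2 : {i | TwoChains.On a b u l i}.ncard + 1 ≤ Fintype.card V := by
      rw [← Set.ncard_insert_of_notMem (s := {i | TwoChains.On a b u l i}) hw (Set.toFinite _),
        ← Nat.card_eq_fintype_card]
      exact Set.ncard_le_card _
    have hwz : ∀ i, F z i ∨ F i z → i = w := fun i hi => h.off_subsingleton (hzoff i hi) hw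
    have hwz' : ∀ i, F z' i ∨ F i z' → i = w := fun i hi => h.off_subsingleton (hzoff' i hi) hw
    have h3 : pairCount F ≤ {p : V × V | F p.1 p.2 ∧ (p.1 ≠ z ∧ p.1 ≠ z') ∧
        (p.2 ≠ z ∧ p.2 ≠ z')}.ncard + {p : V × V | F p.1 p.2 ∧ (p = (z, w) ∨ p = (w, z))}.ncard +
        {p : V × V | F p.1 p.2 ∧ (p = (z', w) ∨ p = (w, z'))}.ncard := by
      refine le_trans (Set.ncard_le_ncard ?_ (Set.toFinite _))
        ((Set.ncard_union_le _ _).trans (Nat.add_le_add_right (Set.ncard_union_le _ _) _))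
      rintro ⟨i, j⟩ (hij : F i j)
      by_cases h1 : i = z
      · have := hwz j (Or.inl (h1 ▸ hij))
        exact Or.inl (Or.inr ⟨hij, Or.inl (by rw [h1, this])⟩)
      by_cases h2 : j = z
      · have := hwz i (Or.inr (h2 ▸ hij))
        exact Or.inl (Or.inr ⟨hij, Or.inr (by rw [h2, this])⟩)
      by_cases h3 : i = z'
      · have := hwz' j (Or.inl (h3 ▸ hij))
        exact Or.inr ⟨hij, Or.inl (by rw [h3, this])⟩
      by_cases h4 : j = z'
      · have := hwz' i (Or.inr (h4 ▸ hij))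
        exact Or.inr ⟨hij, Or.inr (by rw [h4, this])⟩
      exact Or.inl (Or.inl ⟨hij, ⟨h1, h3⟩, h2, h4⟩)
    have hsub : ∀ v, {p : V × V | F p.1 p.2 ∧ (p = (v, w) ∨ p = (w, v))}.Subsingleton := by
      rintro v p ⟨hp, rfl | rfl⟩ q ⟨hq, rfl | rfl⟩
      · rfl
      · exact absurd hq (hF.asymm _ _ hp)
      · exact absurd hq (hF.asymm _ _ hp)
      · rfl
    have hadj : ∀ v, {p : V × V | F p.1 p.2 ∧ (p = (v, w) ∨ p = (w, v))}.Nonempty →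
        F v w ∨ F w v := by
      rintro v ⟨p, hp, rfl | rfl⟩
      · exact Or.inl hp
      · exact Or.inr hp
    have hne : ∀ i, E i w ∨ E w i → TwoChains.On a b u l i := fun i hi => honw i fun h' => by
      subst h'
      exact hEw (hi.elim id id)
    -- If `w` touches `z` in `F`, its left end lies strictly left of the right end of `z`, where no
    -- chain member's right end can meet it.
    have h4 := ncard_add_ncard_le_one (hsub z) (h.subsingleton_left_contacts hE hg hw) (by
      rintro hA ⟨i, hi : E i w⟩
      have h5 := (hFadj _ _ (hadj z hA)).2
      have h6 := hE.gap _ _ hi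
      have := hE.pos i
      have := (abs_lt.1 h5).1
      rcases h.first_le_left hE (hne i (Or.inl hi)) with h7 | h7
      · rw [hz] at h7; subst h7; linarith
      · rw [hz] at h7; linarith)
    have h5 := ncard_add_ncard_le_one (hsub z') (h.subsingleton_right_contacts hE hg hw) (by
      rintro hA ⟨i, hi : E w i⟩
      have h5 := (hFadj _ _ (hadj z' hA)).2
      have h6 := hE.gap _ _ hi
      have := hE.pos i
      have := (abs_lt.1 h5).2
      rcases h.right_le_last hE (hne i (Or.inr hi)) with h7 | h7
      · rw [hz'] at h7; subst h7; linarith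
      · rw [hz'] at h7; linarith)
    -- With m squares the total is at most (m - 1) + (m - 3) + 1 + 1, the last two terms coming from
    -- `h4` and `h5`.
    omega

theorem SideContact.pairCount_add_le_of_isAcyclic [Nonempty V] (hE : SideContact x r E)
    (hF : SideContact y r F) (h : (SimpleGraph.fromRel E).IsAcyclic)
    (h' : (SimpleGraph.fromRel F).IsAcyclic) :
    pairCount E + pairCount F + 2 ≤ 2 * Fintype.card V := by
  have := pairCount_add_one_le_of_isAcyclic hE.asymm h
  have := pairCount_add_one_le_of_isAcyclic hF.asymm h'
  omega

end

/-! ### Axis-parallel squares -/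

section

variable {V : Type*} {x y r : V → ℝ}

/-- The right side of square `i` touches the left side of square `j` along a segment. -/
def SideTouch (x y r : V → ℝ) (i j : V) : Prop := x j - x i = r i + r j ∧ |y i - y j| < r i + r j

/-- Square `j` lies diagonally to the upper right of square `i` with a corner in common, and
some square to the right of the line through that corner lies directly below it. -/
def DiagonalTouch (x y r : V → ℝ) (i j : V) : Prop :=
  x i + r i = x j - r j ∧ y i + r i = y j - r j ∧
    ∃ d, x d - r d = x i + r i ∧ y d + r d = y i + r i

/-- Contacts along vertical sides, together with at most one diagonal contact, have no core on
a line. -/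
theorem sideContact_sideTouch_or (hpos : ∀ i, 0 < r i)
    (hd : ∀ i j, i ≠ j → r i + r j ≤ |x i - x j| ∨ r i + r j ≤ |y i - y j|) (K : V → V → Prop)
    (hK : ∀ i j, K i j → DiagonalTouch x y r i j)
    (hK1 : ∀ i j i' j', K i j → K i' j' → i = i' ∧ j = j') :
    SideContact x r fun i j => SideTouch x y r i j ∨ K i j := by
  have hgap : ∀ i j, SideTouch x y r i j ∨ K i j → x j - x i = r i + r j := by
    rintro i j (h | h)
    · exact h.1
    · have := (hK i j h).1; linarith
  refine ⟨hpos, hgap, ?_⟩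
  intro T v hne hT
  -- For the lowest top, two ordinary neighbours across the line would both occupy the levels just
  -- below that top, hence overlap.
  obtain ⟨m, hm, hmin⟩ := T.exists_min_image (fun i => y i + r i) hne
  -- two squares on the same side of the line that both pass below the level of `m` coincide
  have coincide : ∀ j j', j ∈ T → j' ∈ T → |x j - x j'| < r j + r j' → y j - r j < y m + r m →
      y j' - r j' < y m + r m → j = j' := by
    intro j j' hj hj' hx h1 h2
    by_contra hne
    have h3 := hmin j hj
    have h4 := hmin j' hj'
    rcases hd j j' hne with h | h
    · linarith
    · refine absurd h (not_le.2 (abs_lt.2 ⟨by linarith, by linarith⟩))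
  have below : ∀ i j, SideTouch x y r i j → y j - r j < y i + r i ∧ y i - r i < y j + r j := by
    intro i j h
    have := abs_lt.1 h.2
    constructor <;> linarith
  have sameL : ∀ j j', x j - r j = x j' - r j' → |x j - x j'| < r j + r j' := fun j j' h => by
    have := hpos j
    have := hpos j'
    exact abs_lt.2 ⟨by linarith, by linarith⟩
  have sameR : ∀ j j', x j + r j = x j' + r j' → |x j - x j'| < r j + r j' := fun j j' h => by
    have := hpos j
    have := hpos j'
    exact abs_lt.2 ⟨by linarith, by linarith⟩
  -- a lowest top cannot have both neighbours on its left
  have noleft : ∀ i ∈ T, y i + r i = y m + r m → ∀ j ∈ T, ∀ j' ∈ T, j ≠ j' →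
      (SideTouch x y r j i ∨ K j i) → (SideTouch x y r j' i ∨ K j' i) → False := by
    intro i hi him j hj j' hj' hjj h1 h2
    have real : ∀ j ∈ T, (SideTouch x y r j i ∨ K j i) → SideTouch x y r j i := by
      intro j hj h
      refine h.resolve_right fun h => ?_
      have h3 := (hK _ _ h).2.1
      have h4 := hmin j hj
      have := hpos i
      linarith
    have g1 := hgap _ _ h1
    have g2 := hgap _ _ h2
    refine hjj (coincide j j' hj hj' (sameR _ _ (by linarith)) ?_ ?_)
    · have := (below _ _ (real j hj h1)).2; linarith
    · have := (below _ _ (real j' hj' h2)).2; linarith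
  -- The ordinary neighbour `j'` occupies the levels just below the shared corner, so it is the
  -- square `d` of `DiagonalTouch`. Its top is also lowest, and its own neighbours lie on its left,
  -- which `noleft` excludes.
  have diag : ∀ j ∈ T, ∀ j' ∈ T, j ≠ j' → K m j → (SideTouch x y r m j' ∨ K m j') → False := by
    intro j hj j' hj' hjj h1 h2
    have h2' : SideTouch x y r m j' := h2.resolve_right fun h => hjj (hK1 _ _ _ _ h1 h).2
    obtain ⟨-, -, d, hd1, hd2⟩ := hK _ _ h1
    have hdj : j' = d := by
      by_contra hne
      have g := h2'.1
      have h3 := (below _ _ h2').1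
      have h4 := hmin j' hj'
      have := hpos d
      rcases hd j' d hne with h | h
      · exact absurd h (not_le.2 (sameL _ _ (by linarith)))
      · exact absurd h (not_le.2 (abs_lt.2 ⟨by linarith, by linarith⟩))
    subst hdj
    rcases hT j' hj' with ⟨h3, -⟩ | ⟨-, k, hk, k', hk', hkk, h4, h5⟩
    · have h6 := hT m hm
      have g := h2'.1
      have := hpos j'
      rcases h6 with ⟨h7, -⟩ | ⟨h7, k, hk, k', hk', hkk, h8, h9⟩
      · linarith
      · exact noleft m hm rfl k hk k' hk' hkk h8 h9
    · exact noleft j' hj' hd2 k hk k' hk' hkk h4 h5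
  rcases hT m hm with ⟨-, j, hj, j', hj', hjj, h1, h2⟩ | ⟨-, j, hj, j', hj', hjj, h1, h2⟩
  · rcases h1 with h1 | h1
    · rcases h2 with h2 | h2
      · have g1 := h1.1
        have g2 := h2.1
        exact hjj (coincide j j' hj hj' (sameL _ _ (by linarith)) (below _ _ h1).1 (below _ _ h2).1)
      · exact diag j' hj' j hj hjj.symm h2 (Or.inl h1)
    · exact diag j hj j' hj' hjj h1 h2
  · exact noleft m hm rfl j hj j' hj' hjj h1 h2

/-- Four axis-parallel squares with disjoint interiors and a common point surround it. -/
theorem exists_diagonalTouch (hpos : ∀ i, 0 < r i)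
    (hd : ∀ i j, i ≠ j → r i + r j ≤ |x i - x j| ∨ r i + r j ≤ |y i - y j|)
    (T : Finset V) (hT : T.card = 4) (p q : ℝ)
    (hp : ∀ i ∈ T, |x i - p| ≤ r i ∧ |y i - q| ≤ r i) :
    ∃ c a, DiagonalTouch x y r c a ∧ DiagonalTouch y x r c a := by
  classical
  have near : ∀ {s t : ℝ} {i j : V}, |s| ≤ r i → |t| ≤ r j → (0 ≤ s ↔ 0 ≤ t) →
      |s - t| < r i + r j := by
    intro s t i j hs ht hst
    have := hpos i
    have := hpos j
    rw [abs_le] at hs ht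
    rw [abs_lt]
    by_cases h : 0 ≤ s
    · have := hst.1 h
      constructor <;> linarith
    · have h' : ¬ 0 ≤ t := fun h' => h (hst.2 h')
      push Not at h h'
      constructor <;> linarith
  -- Centres in the same quadrant about the common point would make the squares overlap, so the four
  -- squares occupy the four quadrants.
  have hinj : Set.InjOn (fun i => (decide (0 ≤ x i - p), decide (0 ≤ y i - q))) T := by
    intro i hi j hj hij
    by_contra hne
    simp only [Prod.mk.injEq, decide_eq_decide] at hij
    have h1 := near (hp i hi).1 (hp j hj).1 hij.1
    have h2 := near (hp i hi).2 (hp j hj).2 hij.2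
    rw [sub_sub_sub_cancel_right] at h1 h2
    rcases hd i j hne with h | h <;> linarith
  have hsurj : ∀ v : Bool × Bool, ∃ i ∈ T, (decide (0 ≤ x i - p), decide (0 ≤ y i - q)) = v := by
    intro v
    have h1 := Finset.card_image_of_injOn hinj
    rw [hT] at h1
    have h2 := (Finset.card_eq_iff_eq_univ _).1 (h1.trans (by simp : 4 = Fintype.card (Bool × Bool)))
    simpa using (Finset.ext_iff.1 h2 v).2 (Finset.mem_univ v)
  obtain ⟨A, hA, hA'⟩ := hsurj (true, true)
  obtain ⟨B, hB, hB'⟩ := hsurj (false, true)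
  obtain ⟨C, hC, hC'⟩ := hsurj (false, false)
  obtain ⟨D, hD, hD'⟩ := hsurj (true, false)
  simp only [Prod.mk.injEq, decide_eq_true_eq, decide_eq_false_iff_not] at hA' hB' hC' hD'
  have sep : ∀ {z w : V → ℝ} {p q : ℝ} {i j : V}
      (_ : ∀ i j, i ≠ j → r i + r j ≤ |z i - z j| ∨ r i + r j ≤ |w i - w j|)
      (_ : |z i - p| ≤ r i) (_ : |z j - p| ≤ r j) (_ : |w i - q| ≤ r i) (_ : |w j - q| ≤ r j)
      (_ : (0 ≤ w i - q ↔ 0 ≤ w j - q)) (_ : ¬ 0 ≤ z i - p) (_ : 0 ≤ z j - p),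
      z i + r i = p ∧ z j - r j = p := by
    intro z w p q i j hd h1 h2 h3 h4 h5 h6 h7
    have hij : i ≠ j := by rintro rfl; exact h6 h7
    have h8 := near h3 h4 h5
    rw [sub_sub_sub_cancel_right] at h8
    have h9 := (hd i j hij).resolve_right (not_le.2 h8)
    push Not at h6
    rw [abs_sub_comm, abs_of_nonneg (by linarith)] at h9
    rw [abs_le] at h1 h2
    constructor <;> linarith
  have hd' : ∀ i j, i ≠ j → r i + r j ≤ |y i - y j| ∨ r i + r j ≤ |x i - x j| :=
    fun i j hij => (hd i j hij).symm
  have hBA := sep hd (hp B hB).1 (hp A hA).1 (hp B hB).2 (hp A hA).2 (by simp [hB', hA']) hB'.1 hA'.1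
  have hCD := sep hd (hp C hC).1 (hp D hD).1 (hp C hC).2 (hp D hD).2
    (by simp only [hC'.2, hD'.2]) hC'.1 hD'.1
  have hDA := sep hd' (hp D hD).2 (hp A hA).2 (hp D hD).1 (hp A hA).1 (by simp [hD', hA']) hD'.2 hA'.2
  have hCB := sep hd' (hp C hC).2 (hp B hB).2 (hp C hC).1 (hp B hB).1
    (by simp only [hC'.1, hB'.1]) hC'.2 hB'.2
  -- `C` is lower left and `A` upper right. The lower right `D` is the witness for the first order
  -- of coordinates, the upper left `B` for the swapped one.
  exact ⟨C, A, ⟨by linarith, by linarith, D, by linarith, by linarith⟩,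
    ⟨by linarith, by linarith, B, by linarith, by linarith⟩⟩

variable [Fintype V]

/-- The extra relation goes into a direction that has a cycle: the cycle count needs strict overlap
for the contacts of the other direction, and a diagonal contact lacks it. -/
theorem pairCount_sideTouch_or (hpos : ∀ i, 0 < r i) [Nonempty V] (hg : FewZeroSigns r)
    (hd : ∀ i j, i ≠ j → r i + r j ≤ |x i - x j| ∨ r i + r j ≤ |y i - y j|) (K K' : V → V → Prop)
    (hK : ∀ i j, K i j → DiagonalTouch x y r i j)
    (hK' : ∀ i j, K' i j → DiagonalTouch y x r i j)
    (hK1 : ∀ i j i' j', K i j → K i' j' → i = i' ∧ j = j')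
    (hK1' : ∀ i j i' j', K' i j → K' i' j' → i = i' ∧ j = j') :
    pairCount (fun i j => SideTouch x y r i j ∨ K i j) + pairCount (SideTouch y x r) + 2 ≤
        2 * Fintype.card V ∨
      pairCount (SideTouch x y r) + pairCount (fun i j => SideTouch y x r i j ∨ K' i j) + 2 ≤
        2 * Fintype.card V := by
  have hd' : ∀ i j, i ≠ j → r i + r j ≤ |y i - y j| ∨ r i + r j ≤ |x i - x j| :=
    fun i j hij => (hd i j hij).symm
  have hE := sideContact_sideTouch_or hpos hd K hK hK1
  have hF := sideContact_sideTouch_or hpos hd' K' hK' hK1'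
  have hE0 : SideContact x r (SideTouch x y r) := by
    simpa using sideContact_sideTouch_or hpos hd (fun _ _ => False) (by simp) (by simp)
  have hF0 : SideContact y r (SideTouch y x r) := by
    simpa using sideContact_sideTouch_or hpos hd' (fun _ _ => False) (by simp) (by simp)
  by_cases h1 : (SimpleGraph.fromRel fun i j => SideTouch x y r i j ∨ K i j).IsAcyclic
  · by_cases h2 : (SimpleGraph.fromRel fun i j => SideTouch y x r i j ∨ K' i j).IsAcyclic
    · left
      refine hE.pairCount_add_le_of_isAcyclic hF0 h1 (h2.anti ?_)
      intro i j hij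
      rw [SimpleGraph.fromRel_adj] at hij ⊢
      exact ⟨hij.1, hij.2.imp Or.inl Or.inl⟩
    · right
      have := hF.pairCount_add_le_of_cycle hE0 hg (fun i j h => h.2) h2
      omega
  · left
    exact hE.pairCount_add_le_of_cycle hF0 hg (fun i j h => h.2) h1

/-- Axis-parallel squares with disjoint interiors have at most `2n - 2` contacts along sides. -/
theorem pairCount_sideTouch_le (hpos : ∀ i, 0 < r i) [Nonempty V] (hg : FewZeroSigns r)
    (hd : ∀ i j, i ≠ j → r i + r j ≤ |x i - x j| ∨ r i + r j ≤ |y i - y j|) :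
    pairCount (SideTouch x y r) + pairCount (SideTouch y x r) + 2 ≤ 2 * Fintype.card V := by
  simpa using pairCount_sideTouch_or hpos hg hd (fun _ _ => False) (fun _ _ => False)
    (by simp) (by simp) (by simp) (by simp)

/-- When four of the squares have a common point, the bound on contacts improves by one. -/
theorem pairCount_sideTouch_lt (hpos : ∀ i, 0 < r i) (hg : FewZeroSigns r)
    (hd : ∀ i j, i ≠ j → r i + r j ≤ |x i - x j| ∨ r i + r j ≤ |y i - y j|)
    (T : Finset V) (hT : T.card = 4) (p q : ℝ)
    (hp : ∀ i ∈ T, |x i - p| ≤ r i ∧ |y i - q| ≤ r i) :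
    pairCount (SideTouch x y r) + pairCount (SideTouch y x r) + 3 ≤ 2 * Fintype.card V := by
  obtain ⟨c, a, h1, h2⟩ := exists_diagonalTouch hpos hd T hT p q hp
  have : Nonempty V := ⟨c⟩
  have extra : ∀ {x y : V → ℝ}, DiagonalTouch x y r c a →
      pairCount (SideTouch x y r) + 1 ≤
        pairCount fun i j => SideTouch x y r i j ∨ (i = c ∧ j = a) := by
    intro x y h
    have hn : (c, a) ∉ {p : V × V | SideTouch x y r p.1 p.2} := fun h' => by
      have h3 := (abs_lt.1 h'.2).1
      have := h.2.1
      dsimp only at h3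
      linarith
    unfold pairCount
    rw [← Set.ncard_insert_of_notMem hn (Set.toFinite _)]
    refine Set.ncard_le_ncard ?_ (Set.toFinite _)
    rintro p (rfl | hp)
    · exact Or.inr ⟨rfl, rfl⟩
    · exact Or.inl hp
  have g1 := extra h1
  have g2 := extra h2
  have := pairCount_sideTouch_or hpos hg hd (fun i j => i = c ∧ j = a) (fun i j => i = c ∧ j = a)
    (by rintro i j ⟨rfl, rfl⟩; exact h1) (by rintro i j ⟨rfl, rfl⟩; exact h2)
    (by rintro i j i' j' ⟨rfl, rfl⟩ ⟨rfl, rfl⟩; exact ⟨rfl, rfl⟩)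
    (by rintro i j i' j' ⟨rfl, rfl⟩ ⟨rfl, rfl⟩; exact ⟨rfl, rfl⟩)
  omega

end

/-! ### Rotated frames and the geometry of two squares -/

/-- First coordinate of a point in the frame rotated by `θ`. -/
noncomputable def frameFst (θ : ℝ) (q : ℝ × ℝ) : ℝ := Real.cos θ * q.1 + Real.sin θ * q.2

/-- Second coordinate of a point in the frame rotated by `θ`. -/
noncomputable def frameSnd (θ : ℝ) (q : ℝ × ℝ) : ℝ := -Real.sin θ * q.1 + Real.cos θ * q.2

theorem frameFst_planeRotation (θ : ℝ) (q : ℝ × ℝ) : frameFst θ (planeRotation θ q) = q.1 := by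
  simp only [frameFst, planeRotation]
  linear_combination q.1 * Real.sin_sq_add_cos_sq θ

theorem frameSnd_planeRotation (θ : ℝ) (q : ℝ × ℝ) : frameSnd θ (planeRotation θ q) = q.2 := by
  simp only [frameSnd, planeRotation]
  linear_combination q.2 * Real.sin_sq_add_cos_sq θ

theorem planeRotation_frame (θ : ℝ) (q : ℝ × ℝ) :
    planeRotation θ (frameFst θ q, frameSnd θ q) = q := by
  refine Prod.ext ?_ ?_ <;> simp only [frameSnd, frameFst, planeRotation]
  · linear_combination q.1 * Real.sin_sq_add_cos_sq θ
  · linear_combination q.2 * Real.sin_sq_add_cos_sq θ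

theorem eq_of_frame_eq (θ : ℝ) {q q' : ℝ × ℝ} (h1 : frameFst θ q = frameFst θ q')
    (h2 : frameSnd θ q = frameSnd θ q') : q = q' := by
  rw [← planeRotation_frame θ q, h1, h2, planeRotation_frame]

theorem mem_similarSquare {r : ℝ} (hr : 0 < r) (θ : ℝ) (p q : ℝ × ℝ) :
    q ∈ similarSquare r θ p ↔
      |frameFst θ q - frameFst θ p| ≤ r ∧ |frameSnd θ q - frameSnd θ p| ≤ r := by
  constructor
  · rintro ⟨s, ⟨h1, h2, h3, h4⟩, rfl⟩
    have e1 : frameFst θ (r • planeRotation θ s + p) - frameFst θ p = r * s.1 := by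
      rw [← frameFst_planeRotation θ s]
      simp only [frameFst, Prod.fst_add, Prod.snd_add, Prod.smul_fst, Prod.smul_snd, smul_eq_mul]
      ring
    have e2 : frameSnd θ (r • planeRotation θ s + p) - frameSnd θ p = r * s.2 := by
      rw [← frameSnd_planeRotation θ s]
      simp only [frameSnd, Prod.fst_add, Prod.snd_add, Prod.smul_fst, Prod.smul_snd, smul_eq_mul]
      ring
    dsimp only
    rw [e1, e2, abs_mul, abs_mul, abs_of_pos hr]
    exact ⟨mul_le_of_le_one_right hr.le (abs_le.2 ⟨h1, h2⟩),
      mul_le_of_le_one_right hr.le (abs_le.2 ⟨h3, h4⟩)⟩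
  · rintro ⟨h1, h2⟩
    refine ⟨((frameFst θ q - frameFst θ p) / r, (frameSnd θ q - frameSnd θ p) / r), ?_, ?_⟩
    · have h : ∀ s : ℝ, |s| ≤ r → -1 ≤ s / r ∧ s / r ≤ 1 := fun s hs => by
        rw [abs_le] at hs
        rw [le_div_iff₀ hr, div_le_iff₀ hr]
        constructor <;> linarith
      exact ⟨(h _ h1).1, (h _ h1).2, (h _ h2).1, (h _ h2).2⟩
    · refine Prod.ext ?_ ?_ <;>
        simp only [frameSnd, frameFst, planeRotation, Prod.fst_add, Prod.snd_add, Prod.smul_fst,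
          Prod.smul_snd, smul_eq_mul] <;> field_simp
      · linear_combination (q.1 - p.1) * Real.sin_sq_add_cos_sq θ
      · linear_combination (q.2 - p.2) * Real.sin_sq_add_cos_sq θ

theorem mem_interior_similarSquare {r : ℝ} (hr : 0 < r) {θ : ℝ} {p q : ℝ × ℝ}
    (h1 : |frameFst θ q - frameFst θ p| < r) (h2 : |frameSnd θ q - frameSnd θ p| < r) :
    q ∈ interior (similarSquare r θ p) := by
  refine interior_maximal (s := similarSquare r θ p)
    (t := {q | |frameFst θ q - frameFst θ p| < r} ∩ {q | |frameSnd θ q - frameSnd θ p| < r})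
    ?_ ?_ ⟨h1, h2⟩
  · rintro q ⟨h1, h2⟩
    exact (mem_similarSquare hr θ p q).2 ⟨le_of_lt h1, le_of_lt h2⟩
  · refine (isOpen_lt ?_ continuous_const).inter (isOpen_lt ?_ continuous_const)
    · unfold frameFst; fun_prop
    · unfold frameSnd; fun_prop

theorem exists_abs_sub_lt {a b s t : ℝ} (hs : 0 < s) (ht : 0 < t) (h : |a - b| < s + t) :
    ∃ c, |c - a| < s ∧ |c - b| < t := by
  have hst : 0 < s + t := by linarith
  refine ⟨(t * a + s * b) / (s + t), ?_, ?_⟩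
  · rw [show (t * a + s * b) / (s + t) - a = -(s * ((a - b) / (s + t))) by field_simp; ring,
      abs_neg, abs_mul, abs_of_pos hs, abs_div, abs_of_pos hst]
    exact mul_lt_of_lt_one_right hs ((div_lt_one hst).2 h)
  · rw [show (t * a + s * b) / (s + t) - b = t * ((a - b) / (s + t)) by field_simp; ring,
      abs_mul, abs_of_pos ht, abs_div, abs_of_pos hst]
    exact mul_lt_of_lt_one_right ht ((div_lt_one hst).2 h)

/-- Squares of the same angle with disjoint interiors are separated along one of the axes. -/
theorem separated_of_disjoint_interior {r s θ : ℝ} (hr : 0 < r) (hs : 0 < s) {p q : ℝ × ℝ}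
    (h : Disjoint (interior (similarSquare r θ p)) (interior (similarSquare s θ q))) :
    r + s ≤ |frameFst θ p - frameFst θ q| ∨ r + s ≤ |frameSnd θ p - frameSnd θ q| := by
  by_contra hcon
  push Not at hcon
  obtain ⟨c, hc1, hc2⟩ := exists_abs_sub_lt hr hs hcon.1
  obtain ⟨d, hd1, hd2⟩ := exists_abs_sub_lt hr hs hcon.2
  refine h.notMem_of_mem_left (a := planeRotation θ (c, d)) ?_ ?_ <;>
    apply mem_interior_similarSquare <;>
    simpa only [frameFst_planeRotation, frameSnd_planeRotation]

/-- Moving `m` slightly towards the centre `q` would otherwise produce a point interior to both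
squares. -/
theorem notMem_interior_of_disjoint {r s θ φ : ℝ} (hs : 0 < s) {p q m : ℝ × ℝ}
    (h : Disjoint (interior (similarSquare r θ p)) (interior (similarSquare s φ q)))
    (hm : m ∈ similarSquare s φ q) : m ∉ interior (similarSquare r θ p) := by
  intro hmi
  have hcont : Continuous fun t : ℝ => m + t • (q - m) := by fun_prop
  have hev : ∀ᶠ t in nhdsWithin (0 : ℝ) (Set.Ioi 0),
      m + t • (q - m) ∈ interior (similarSquare r θ p) := by
    refine (hcont.tendsto 0).mono_left nhdsWithin_le_nhds (isOpen_interior.mem_nhds ?_)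
    simpa using hmi
  obtain ⟨t, ht1, ht0, ht2⟩ := (hev.and (Ioo_mem_nhdsGT (zero_lt_one' ℝ))).exists
  refine Set.disjoint_left.1 h ht1 ?_
  rw [mem_similarSquare hs] at hm
  have h1 : frameFst φ (m + t • (q - m)) - frameFst φ q =
      (1 - t) * (frameFst φ m - frameFst φ q) := by
    simp only [frameFst, Prod.fst_add, Prod.snd_add, Prod.smul_fst, Prod.smul_snd, smul_eq_mul,
      Prod.fst_sub, Prod.snd_sub]
    ring
  have h2 : frameSnd φ (m + t • (q - m)) - frameSnd φ q =
      (1 - t) * (frameSnd φ m - frameSnd φ q) := by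
    simp only [frameSnd, Prod.fst_add, Prod.snd_add, Prod.smul_fst, Prod.smul_snd, smul_eq_mul,
      Prod.fst_sub, Prod.snd_sub]
    ring
  have h3 : ∀ c : ℝ, |c| ≤ s → |(1 - t) * c| < s := fun c hc => by
    rw [abs_mul, abs_of_pos (by linarith)]
    calc (1 - t) * |c| ≤ (1 - t) * s := mul_le_mul_of_nonneg_left hc (by linarith)
      _ < s := by nlinarith
  exact mem_interior_similarSquare hs (h1 ▸ h3 _ hm.1) (h2 ▸ h3 _ hm.2)

/-- A segment in a square whose midpoint is not interior is parallel to one of the sides. -/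
theorem frame_eq_or_of_midpoint {r θ : ℝ} (hr : 0 < r) {p z z' : ℝ × ℝ}
    (hz : z ∈ similarSquare r θ p) (hz' : z' ∈ similarSquare r θ p)
    (hm : midpoint ℝ z z' ∉ interior (similarSquare r θ p)) :
    frameFst θ z = frameFst θ z' ∨ frameSnd θ z = frameSnd θ z' := by
  rw [mem_similarSquare hr] at hz hz'
  have h1 : frameFst θ (midpoint ℝ z z') = (frameFst θ z + frameFst θ z') / 2 := by
    simp only [frameFst, midpoint_eq_smul_add, Prod.smul_fst, Prod.smul_snd, Prod.fst_add,
      Prod.snd_add, smul_eq_mul, invOf_eq_inv]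
    ring
  have h2 : frameSnd θ (midpoint ℝ z z') = (frameSnd θ z + frameSnd θ z') / 2 := by
    simp only [frameSnd, midpoint_eq_smul_add, Prod.smul_fst, Prod.smul_snd, Prod.fst_add,
      Prod.snd_add, smul_eq_mul, invOf_eq_inv]
    ring
  have key : ∀ c a b : ℝ, |a - c| ≤ r → |b - c| ≤ r → a ≠ b → |(a + b) / 2 - c| < r := by
    intro c a b ha hb hab
    rw [abs_le] at ha hb
    rw [abs_lt]
    rcases lt_or_gt_of_ne hab with h | h <;> constructor <;> linarith
  by_contra hcon
  push Not at hcon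
  exact hm (mem_interior_similarSquare hr (h1 ▸ key _ _ _ hz.1 hz'.1 hcon.1)
    (h2 ▸ key _ _ _ hz.2 hz'.2 hcon.2))

/-- A direction determines the angle of a square in [0, π/2) having a side along it. In the mixed
cases `cos (θ - φ)` would vanish, although |θ - φ| < π/2. -/
theorem angle_eq_of_parallel {θ φ : ℝ} (hθ : θ ∈ Set.Ico 0 (Real.pi / 2))
    (hφ : φ ∈ Set.Ico 0 (Real.pi / 2)) {z z' : ℝ × ℝ} (hz : z ≠ z')
    (h1 : frameFst θ z = frameFst θ z' ∨ frameSnd θ z = frameSnd θ z')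
    (h2 : frameFst φ z = frameFst φ z' ∨ frameSnd φ z = frameSnd φ z') : θ = φ := by
  have hne : z.1 - z'.1 ≠ 0 ∨ z.2 - z'.2 ≠ 0 := by
    by_contra h
    push Not at h
    exact hz (Prod.ext (sub_eq_zero.1 h.1) (sub_eq_zero.1 h.2))
  have hcos : Real.cos (θ - φ) ≠ 0 :=
    (Real.cos_pos_of_mem_Ioo ⟨by linarith [hθ.1, hφ.2], by linarith [hθ.2, hφ.1]⟩).ne'
  have hsin : Real.sin (θ - φ) = 0 → θ = φ := fun h => by
    have := (Real.sin_eq_zero_iff_of_lt_of_lt (by linarith [hθ.1, hφ.2, Real.pi_pos])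
      (by linarith [hθ.2, hφ.1, Real.pi_pos])).1 h
    linarith
  have zero : ∀ s : ℝ, s * (z.1 - z'.1) = 0 → s * (z.2 - z'.2) = 0 → s = 0 := fun s hs hs' => by
    rcases hne with h | h
    · exact (mul_eq_zero.1 hs).resolve_right h
    · exact (mul_eq_zero.1 hs').resolve_right h
  simp only [frameFst, frameSnd] at h1 h2
  rw [Real.cos_sub] at hcos
  rw [Real.sin_sub] at hsin
  rcases h1 with h1 | h1 <;> rcases h2 with h2 | h2
  · exact hsin (zero _ (by linear_combination Real.sin θ * h2 - Real.sin φ * h1)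
      (by linear_combination Real.cos φ * h1 - Real.cos θ * h2))
  · exact absurd (zero _ (by linear_combination Real.cos φ * h1 - Real.sin θ * h2)
      (by linear_combination Real.sin φ * h1 + Real.cos θ * h2)) hcos
  · exact absurd (zero _ (by linear_combination Real.cos θ * h2 - Real.sin φ * h1)
      (by linear_combination Real.cos φ * h1 + Real.sin θ * h2)) hcos
  · exact hsin (zero _ (by linear_combination Real.cos θ * h2 - Real.cos φ * h1)
      (by linear_combination Real.sin θ * h2 - Real.sin φ * h1))

/-! ### From packings to classes of equal angle -/

/-- Signs on a subfamily extend by zero, which only adds zeros, so genericity passes to each angle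
class. -/
theorem WeakGeneric.fewZeroSigns {n : ℕ} {r : Fin n → ℝ} (h : WeakGeneric r) (p : Fin n → Prop)
    [DecidablePred p] :
    FewZeroSigns fun i : {i // p i} => r i := by
  intro σ hσ hsum T hT hzero i
  have := h (fun i => if hi : p i then σ ⟨i, hi⟩ else 0) ?_ ?_ ?_ i
  · simpa [i.2] using this
  · intro i
    split_ifs
    · exact hσ _
    · simp
  · rw [← T.card_map (Function.Embedding.subtype p)] at hT
    refine hT.trans (Finset.card_le_card ?_)
    intro i hi
    obtain ⟨j, hj, rfl⟩ := Finset.mem_map.1 hi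
    simp [j.2, hzero j hj]
  · rw [← Fintype.sum_subtype_add_sum_subtype p]
    have h1 : ∑ i : {i // ¬ p i}, ((if hi : p i then σ ⟨i, hi⟩ else 0 : ℤ) : ℝ) * r i = 0 :=
      Finset.sum_eq_zero fun i _ => by simp [i.2]
    rw [h1, add_zero, ← hsum]
    exact Finset.sum_congr rfl fun i _ => by simp [i.2]

theorem isHomotheticCopy_planeRotation_neg {r : ℝ} (hr : 0 < r) (θ : ℝ) (p : ℝ × ℝ) :
    IsHomotheticCopy standardSquare (planeRotation (-θ) '' similarSquare r θ p) := by
  refine ⟨r, hr, planeRotation (-θ) p, ?_⟩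
  rw [similarSquare, Set.image_image]
  refine Set.image_congr fun q _ => ?_
  refine Prod.ext ?_ ?_ <;>
    simp only [planeRotation, Prod.fst_add, Prod.snd_add, Prod.smul_fst, Prod.smul_snd,
      smul_eq_mul, Real.cos_neg, Real.sin_neg]
  · linear_combination r * q.1 * Real.sin_sq_add_cos_sq θ
  · linear_combination r * q.2 * Real.sin_sq_add_cos_sq θ

namespace SquarePacking

variable {n : ℕ} {r : Fin n → ℝ}

/-- First coordinates, in the frame rotated by `θ`, of the centres of the squares of angle `θ`. -/
noncomputable def classFst (P : SquarePacking r) (θ : ℝ) (i : {i // P.angle i = θ}) : ℝ :=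
  frameFst θ (P.center i)

/-- Second coordinates, in the frame rotated by `θ`, of the centres of the squares of angle `θ`. -/
noncomputable def classSnd (P : SquarePacking r) (θ : ℝ) (i : {i // P.angle i = θ}) : ℝ :=
  frameSnd θ (P.center i)

/-- The radii of the squares of angle `θ`. -/
def classRadius (P : SquarePacking r) (θ : ℝ) (i : {i // P.angle i = θ}) : ℝ := r i

theorem class_separated (P : SquarePacking r) (hr : ∀ i, 0 < r i) (θ : ℝ)
    (i j : {i // P.angle i = θ}) (hij : i ≠ j) :
    P.classRadius θ i + P.classRadius θ j ≤ |P.classFst θ i - P.classFst θ j| ∨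
      P.classRadius θ i + P.classRadius θ j ≤ |P.classSnd θ i - P.classSnd θ j| := by
  have h := P.interior_disjoint i j (fun h => hij (Subtype.ext h))
  rw [i.2, j.2] at h
  exact separated_of_disjoint_interior (hr i) (hr j) h

/-- The midpoint of the contact segment lies in both squares, hence in the interior of neither, so
the segment is parallel to a side of each. -/
theorem angle_eq_of_adj (P : SquarePacking r) (hr : ∀ i, 0 < r i) {i j : Fin n}
    (h : P.faceGraph.Adj i j) : P.angle i = P.angle j := by
  obtain ⟨hij, z, z', hz, hseg⟩ := h
  have hz1 : z ∈ P.square i ∩ P.square j := hseg ▸ left_mem_segment ℝ z z'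
  have hz2 : z' ∈ P.square i ∩ P.square j := hseg ▸ right_mem_segment ℝ z z'
  have hm : midpoint ℝ z z' ∈ P.square i ∩ P.square j := hseg ▸ midpoint_mem_segment z z'
  exact angle_eq_of_parallel (P.angle_mem i) (P.angle_mem j) hz
    (frame_eq_or_of_midpoint (hr i) hz1.1 hz2.1
      (notMem_interior_of_disjoint (hr j) (P.interior_disjoint i j hij) hm.2))
    (frame_eq_or_of_midpoint (hr j) hz1.2 hz2.2
      (notMem_interior_of_disjoint (hr i) (P.interior_disjoint j i hij.symm) hm.1))

/-- In a coordinate that varies along the segment the squares overlap strictly, so they are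
separated, and touch, in the other coordinate. -/
theorem sideTouch_of_adj (P : SquarePacking r) (hr : ∀ i, 0 < r i) {θ : ℝ}
    {i j : {i // P.angle i = θ}} (h : P.faceGraph.Adj i j) :
    (SideTouch (P.classFst θ) (P.classSnd θ) (P.classRadius θ) i j ∨
      SideTouch (P.classSnd θ) (P.classFst θ) (P.classRadius θ) i j) ∨
    (SideTouch (P.classFst θ) (P.classSnd θ) (P.classRadius θ) j i ∨
      SideTouch (P.classSnd θ) (P.classFst θ) (P.classRadius θ) j i) := by
  obtain ⟨hij, z, z', hz, hseg⟩ := h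
  have hz1 : z ∈ P.square i ∩ P.square j := hseg ▸ left_mem_segment ℝ z z'
  have hz2 : z' ∈ P.square i ∩ P.square j := hseg ▸ right_mem_segment ℝ z z'
  have hsep := P.class_separated hr θ i j (fun h => hij (congrArg Subtype.val h))
  simp only [square, i.2, j.2] at hz1 hz2
  have a1 := (mem_similarSquare (hr i) _ _ _).1 hz1.1
  have a2 := (mem_similarSquare (hr j) _ _ _).1 hz1.2
  have b1 := (mem_similarSquare (hr i) _ _ _).1 hz2.1
  have b2 := (mem_similarSquare (hr j) _ _ _).1 hz2.2
  -- two distinct common values force the intervals to overlap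
  have overlap : ∀ {c d s t a b : ℝ}, |a - c| ≤ s → |a - d| ≤ t → |b - c| ≤ s → |b - d| ≤ t →
      a ≠ b → |c - d| < s + t := by
    intro c d s t a b h1 h2 h3 h4 hab
    rw [abs_le] at h1 h2 h3 h4
    rw [abs_lt]
    rcases lt_or_gt_of_ne hab with h | h <;> constructor <;> linarith
  have touch : ∀ {c d s t a : ℝ}, |a - c| ≤ s → |a - d| ≤ t → s + t ≤ |c - d| →
      d - c = s + t ∨ c - d = t + s := by
    intro c d s t a h1 h2 h
    rw [abs_le] at h1 h2
    rcases le_abs.1 h with h | h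
    · right; linarith
    · left; linarith
  by_cases hne : frameFst θ z = frameFst θ z'
  · have hne' : frameSnd θ z ≠ frameSnd θ z' := fun h => hz (eq_of_frame_eq θ hne h)
    have ho : |P.classSnd θ i - P.classSnd θ j| < P.classRadius θ i + P.classRadius θ j :=
      overlap a1.2 a2.2 b1.2 b2.2 hne'
    rcases touch a1.1 a2.1 (hsep.resolve_right (not_le.2 ho)) with h | h
    · exact Or.inl (Or.inl ⟨h, ho⟩)
    · exact Or.inr (Or.inl ⟨h, by rw [abs_sub_comm, add_comm]; exact ho⟩)
  · have ho : |P.classFst θ i - P.classFst θ j| < P.classRadius θ i + P.classRadius θ j :=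
      overlap a1.1 a2.1 b1.1 b2.1 hne
    rcases touch a1.2 a2.2 (hsep.resolve_left (not_le.2 ho)) with h | h
    · exact Or.inl (Or.inr ⟨h, ho⟩)
    · exact Or.inr (Or.inr ⟨h, by rw [abs_sub_comm, add_comm]; exact ho⟩)

/-- The number of contacts along sides among the squares of angle `θ`. -/
noncomputable def classContacts (P : SquarePacking r) (θ : ℝ) : ℕ :=
  pairCount (SideTouch (P.classFst θ) (P.classSnd θ) (P.classRadius θ)) +
    pairCount (SideTouch (P.classSnd θ) (P.classFst θ) (P.classRadius θ))

theorem numFaceContacts_le_sum (P : SquarePacking r) (hr : ∀ i, 0 < r i) :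
    P.numFaceContacts ≤ ∑ θ ∈ Finset.univ.image P.angle, P.classContacts θ := by
  classical
  have hset : ∀ θ, {p : {i // P.angle i = θ} × {i // P.angle i = θ} |
      SideTouch (P.classFst θ) (P.classSnd θ) (P.classRadius θ) p.1 p.2 ∨
        SideTouch (P.classSnd θ) (P.classFst θ) (P.classRadius θ) p.1 p.2}.ncard ≤
      P.classContacts θ := fun θ => Set.ncard_union_le _ _
  refine le_trans ?_ (Finset.sum_le_sum fun θ _ => hset θ)
  have hsub : P.faceGraph.edgeSet ⊆ ⋃ θ ∈ Finset.univ.image P.angle,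
      (fun p : {i // P.angle i = θ} × {i // P.angle i = θ} => s((p.1 : Fin n), (p.2 : Fin n))) ''
        {p | SideTouch (P.classFst θ) (P.classSnd θ) (P.classRadius θ) p.1 p.2 ∨
          SideTouch (P.classSnd θ) (P.classFst θ) (P.classRadius θ) p.1 p.2} := by
    intro e
    induction e using Sym2.ind with
    | _ i j =>
      intro he
      rw [SimpleGraph.mem_edgeSet] at he
      have hang := P.angle_eq_of_adj hr he
      simp only [Set.mem_iUnion]
      refine ⟨P.angle i, Finset.mem_image_of_mem _ (Finset.mem_univ i), ?_⟩
      rcases P.sideTouch_of_adj hr (i := ⟨i, rfl⟩) (j := ⟨j, hang.symm⟩) he with h | h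
      · exact ⟨(⟨i, rfl⟩, ⟨j, hang.symm⟩), h, rfl⟩
      · exact ⟨(⟨j, hang.symm⟩, ⟨i, rfl⟩), h, Sym2.eq_swap⟩
  refine (Set.ncard_le_ncard hsub (Set.toFinite _)).trans ?_
  refine (Finset.set_ncard_biUnion_le _ _).trans (Finset.sum_le_sum fun θ _ => ?_)
  exact Set.ncard_image_le (Set.toFinite _)

theorem classContacts_add_two_le (P : SquarePacking r) (hr : ∀ i, 0 < r i) (hgen : WeakGeneric r)
    {θ : ℝ} (hθ : ∃ i, P.angle i = θ) :
    P.classContacts θ + 2 ≤ 2 * Fintype.card {i // P.angle i = θ} := by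
  have : Nonempty {i // P.angle i = θ} := hθ.elim fun i hi => ⟨⟨i, hi⟩⟩
  exact pairCount_sideTouch_le (fun i => hr i) (hgen.fewZeroSigns _) (P.class_separated hr θ)

theorem classContacts_add_three_le (P : SquarePacking r) (hr : ∀ i, 0 < r i)
    (hgen : WeakGeneric r) {θ : ℝ} (hθ : ∀ i, P.angle i = θ) (hfour : P.HasFourSharingCorner) :
    P.classContacts θ + 3 ≤ 2 * Fintype.card {i // P.angle i = θ} := by
  classical
  obtain ⟨T, hT, q, hq⟩ := hfour
  simp only [Set.mem_iInter] at hq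
  refine pairCount_sideTouch_lt (fun i => hr i) (hgen.fewZeroSigns _) (P.class_separated hr θ)
    (T.subtype fun i => P.angle i = θ) ?_ (frameFst θ q) (frameSnd θ q) ?_
  · rw [Finset.card_subtype, Finset.filter_true_of_mem fun i _ => hθ i, hT]
  · intro i hi
    have h := hq i (Finset.mem_subtype.1 hi)
    rw [square, i.2, mem_similarSquare (hr i)] at h
    rw [abs_sub_comm, abs_sub_comm (P.classSnd θ i)]
    exact h

/-- Keeping the number of angles in the bound is what makes the extremal packings use a single
angle. -/
theorem numFaceContacts_add_two_mul_card_le (P : SquarePacking r) (hr : ∀ i, 0 < r i)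
    (hgen : WeakGeneric r) :
    P.numFaceContacts + 2 * (Finset.univ.image P.angle).card ≤ 2 * n := by
  classical
  have h1 := P.numFaceContacts_le_sum hr
  have h2 : ∑ θ ∈ Finset.univ.image P.angle, (P.classContacts θ + 2) ≤
      ∑ θ ∈ Finset.univ.image P.angle, 2 * Fintype.card {i // P.angle i = θ} :=
    Finset.sum_le_sum fun θ hθ => P.classContacts_add_two_le hr hgen (by simpa using hθ)
  have h3 : ∑ θ ∈ Finset.univ.image P.angle, Fintype.card {i // P.angle i = θ} = n := by
    have := Finset.card_eq_sum_card_image P.angle Finset.univ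
    rw [Finset.card_univ, Fintype.card_fin] at this
    exact (Finset.sum_congr rfl fun θ _ => Fintype.card_subtype _).trans this.symm
  rw [Finset.sum_add_distrib, ← Finset.mul_sum, h3, Finset.sum_const, smul_eq_mul] at h2
  omega

end SquarePacking

theorem mainTheorem2 {n : ℕ} (hn : 1 ≤ n) (r : Fin n → ℝ) (hr : ∀ i, 0 < r i)
    (hgen : WeakGeneric r) (P : SquarePacking r) :
    P.numFaceContacts ≤ 2 * n - 2 ∧
      (P.numFaceContacts = 2 * n - 2 → P.IsHomothetic ∧ ¬ P.HasFourSharingCorner) := by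
  have hbound := P.numFaceContacts_add_two_mul_card_le hr hgen
  have hpos : 0 < (Finset.univ.image P.angle).card :=
    Finset.card_pos.2 ⟨_, Finset.mem_image_of_mem _ (Finset.mem_univ (⟨0, hn⟩ : Fin n))⟩
  refine ⟨by omega, fun heq => ?_⟩
  obtain ⟨θ, hθ⟩ := Finset.card_eq_one.1 (show (Finset.univ.image P.angle).card = 1 by omega)
  have hang : ∀ i, P.angle i = θ := fun i => by
    rw [← Finset.mem_singleton, ← hθ]
    exact Finset.mem_image_of_mem _ (Finset.mem_univ i)
  refine ⟨⟨-θ, fun i => ?_⟩, fun hfour => ?_⟩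
  · rw [SquarePacking.square, hang]
    exact isHomotheticCopy_planeRotation_neg (hr i) θ _
  · have h1 := P.numFaceContacts_le_sum hr
    have h2 := P.classContacts_add_three_le hr hgen hang hfour
    rw [hθ, Finset.sum_singleton] at h1
    have h3 := Fintype.card_subtype_le fun i => P.angle i = θ
    rw [Fintype.card_fin] at h3
    omega
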